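/- Let $K$ be a field of characteristic $0$, $n\ge 0$, $R_n=K[x_1,\dots,x_n]$, and let $D_n$ be the $n$-th Weyl algebra over $K$, i.e. the associative $K$-algebra generated by $x_1,\dots,x_n,\partial_1,\dots,\partial_n$ with relations $x_jx_i=x_ix_j$, $\partial_j\partial_i=\partial_i\partial_j$, $\partial_ix_j=x_j\partial_i+\delta_{ij}$. Let $D_n[s]=D_n\otimes_K K[s]$, with $s$ central. Let $f\in R_n$ be a non-zero polynomial, and let $M=R_n[s,\tfrac1f]\cdot f^s$ be the free $R_n[s,\tfrac1f]$-module of rank one on the symbol $f^s$, made into a left $D_n[s]$-module by letting $x_i$ and $s$ act by multiplication and $$\partial_i(g\cdot f^s)=\Big(\frac{\partial g}{\partial x_i}+s\,g\,\frac{\partial f}{\partial x_i}\,\frac1f\Big)\cdot f^s .$$ Let $b_f(s)\in K[s]$ be the Bernstein–Sato polynomial of $f$: the monic polynomial $b(s)$ of minimal degree for which there is $P(s)\in D_n[s]$ with $P(s)f\cdot f^s=b(s)\cdot f^s$ in $M$. Let $P_1(s),\dots,P_k(s)$ be a system of generators of the left ideal $\mathrm{ann}_{D_n[s]}(f^s)=\{P\in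 D_n[s] : P\cdot f^s=0\}$, and let $\alpha\in\mathbb{Q}_{>0}$. The following are equivalent, where $D_n[s]\langle\cdots\rangle$ and $D_n\langle\cdots\rangle$ denote left ideals: 1. $\alpha$ is a root of $b_f(-s)$; 2. $D_n[s]\langle P_1(s),\dots,P_k(s),f,s+\alpha\rangle\ne D_n[s]$; 3. $D_n\langle P_1(-\alpha),\dots,P_k(-\alpha),f\rangle\ne D_n$. Moreover, in that case $$D_n[s]\langle P_1(s),\dots,P_k(s),f,s+\alpha\rangle\cap K[s]=K[s]\langle s+\alpha\rangle .$$ -/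

import Mathlib

open Polynomial

noncomputable section

namespace WeylBS

/-! ### The Weyl algebra -/

/-- Generators of the Weyl algebra: the symbols `x i` and `d i` (for `∂ i`). -/
inductive Gen (n : ℕ) : Type
  | x (i : Fin n) : Gen n
  | d (i : Fin n) : Gen n

/-- The defining relations of the `n`-th Weyl algebra. -/
inductive Rel (K : Type*) [Field K] (n : ℕ) :
    FreeAlgebra K (Gen n) → FreeAlgebra K (Gen n) → Prop
  | xx (i j : Fin n) : Rel K n
      (FreeAlgebra.ι K (Gen.x j) * FreeAlgebra.ι K (Gen.x i))
      (FreeAlgebra.ι K (Gen.x i) * FreeAlgebra.ι K (Gen.x j))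
  | dd (i j : Fin n) : Rel K n
      (FreeAlgebra.ι K (Gen.d j) * FreeAlgebra.ι K (Gen.d i))
      (FreeAlgebra.ι K (Gen.d i) * FreeAlgebra.ι K (Gen.d j))
  | dx (i j : Fin n) : Rel K n
      (FreeAlgebra.ι K (Gen.d i) * FreeAlgebra.ι K (Gen.x j))
      (FreeAlgebra.ι K (Gen.x j) * FreeAlgebra.ι K (Gen.d i) + if i = j then 1 else 0)

/-- The `n`-th Weyl algebra `D_n` over `K`, by generators and relations. -/
def Weyl (K : Type*) [Field K] (n : ℕ) : Type _ := RingQuot (Rel K n)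

instance (K : Type*) [Field K] (n : ℕ) : Ring (Weyl K n) :=
  inferInstanceAs (Ring (RingQuot (Rel K n)))

instance (K : Type*) [Field K] (n : ℕ) : Algebra K (Weyl K n) :=
  inferInstanceAs (Algebra K (RingQuot (Rel K n)))

variable (K : Type*) [Field K] {n : ℕ}

/-- The quotient map from the free algebra to the Weyl algebra. -/
def Weyl.mk : FreeAlgebra K (Gen n) →ₐ[K] Weyl K n := RingQuot.mkAlgHom K (Rel K n)

theorem Weyl.mk_surjective : Function.Surjective (Weyl.mk K (n := n)) :=
  RingQuot.mkAlgHom_surjective K (Rel K n)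

theorem Weyl.mk_rel {a b : FreeAlgebra K (Gen n)} (h : Rel K n a b) :
    Weyl.mk K a = Weyl.mk K b :=
  RingQuot.mkAlgHom_rel K h

/-- The element `x i` of the Weyl algebra. -/
def Weyl.x (i : Fin n) : Weyl K n := Weyl.mk K (FreeAlgebra.ι K (Gen.x i))

/-- The element `∂ i` of the Weyl algebra. -/
def Weyl.d (i : Fin n) : Weyl K n := Weyl.mk K (FreeAlgebra.ι K (Gen.d i))

theorem Weyl.x_mul_x (i j : Fin n) : Weyl.x K j * Weyl.x K i = Weyl.x K i * Weyl.x K j := by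
  simpa [Weyl.x] using Weyl.mk_rel K (Rel.xx i j)

/-- The subalgebra of `D_n` generated by the `x i` is commutative. -/
instance Weyl.commRingAdjoinX : CommRing (Algebra.adjoin K (Set.range (Weyl.x K (n := n)))) :=
  { (inferInstance : Ring (Algebra.adjoin K (Set.range (Weyl.x K (n := n))))) with
    mul_comm := by
      have := Algebra.isMulCommutative_adjoin K (s := Set.range (Weyl.x K (n := n))) (by
        rintro _ ⟨i, rfl⟩ _ ⟨j, rfl⟩
        exact Weyl.x_mul_x K j i)
      exact fun a b => mul_comm' a b }

theorem Weyl.d_mul_d (i j : Fin n) : Weyl.d K j * Weyl.d K i = Weyl.d K i * Weyl.d K j := by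
  simpa [Weyl.d] using Weyl.mk_rel K (Rel.dd i j)

theorem Weyl.d_mul_x (i j : Fin n) :
    Weyl.d K i * Weyl.x K j = Weyl.x K j * Weyl.d K i + if i = j then 1 else 0 := by
  have := Weyl.mk_rel K (Rel.dx i j)
  split_ifs at this ⊢ <;> simpa [Weyl.d, Weyl.x] using this

/-- The universal property of the Weyl algebra. -/
def Weyl.lift {B : Type*} [Ring B] [Algebra K B] (g : FreeAlgebra K (Gen n) →ₐ[K] B)
    (h : ∀ ⦃a b⦄, Rel K n a b → g a = g b) : Weyl K n →ₐ[K] B :=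
  RingQuot.liftAlgHom K ⟨g, h⟩

theorem Weyl.lift_mk {B : Type*} [Ring B] [Algebra K B] (g : FreeAlgebra K (Gen n) →ₐ[K] B)
    (h : ∀ ⦃a b⦄, Rel K n a b → g a = g b) (a : FreeAlgebra K (Gen n)) :
    Weyl.lift K g h (Weyl.mk K a) = g a :=
  RingQuot.liftAlgHom_mkAlgHom_apply K g h a

/-- The homomorphism `R_n = K[x_1, …, x_n] → D_n` that sends each variable `x i` to the
element `x i` of the Weyl algebra (it factors through the commutative subalgebra generated
by the `x i`). -/
def Weyl.ofPoly : MvPolynomial (Fin n) K →ₐ[K] Weyl K n :=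
  (Algebra.adjoin K (Set.range (Weyl.x K (n := n)))).val.comp
    (MvPolynomial.aeval fun i => ⟨Weyl.x K i, Algebra.subset_adjoin ⟨i, rfl⟩⟩)

theorem Weyl.ofPoly_X (i : Fin n) : Weyl.ofPoly K (MvPolynomial.X i) = Weyl.x K i := by
  simp [Weyl.ofPoly]

/-- The ring `D_n[s]`: polynomials in a central variable `s` over the Weyl algebra. -/
abbrev WeylS (K : Type*) [Field K] (n : ℕ) : Type _ := (Weyl K n)[X]

/-- The embedding `K[s] → D_n[s]`. -/
def WeylS.ofKs : K[X] →+* WeylS K n := Polynomial.mapRingHom (algebraMap K (Weyl K n))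

/-- The homomorphism `R_n → D_n[s]`. -/
def WeylS.ofPoly : MvPolynomial (Fin n) K →+* WeylS K n :=
  (Polynomial.C : Weyl K n →+* WeylS K n).comp (Weyl.ofPoly K (n := n)).toRingHom

/-! ### Extending derivations to `R[1/f]` and to `R[1/f][s]` -/

section Extend

variable {K} {R : Type*} [CommRing R] [Algebra K R] (D : Derivation K R R) (f : R)

/-- The ring homomorphism `g ↦ g + ε D(g)` from `R` to the dual numbers over `R[1/f]`. -/
def toDual : R →+* TrivSqZeroExt (Localization.Away f) (Localization.Away f) where
  toFun g := TrivSqZeroExt.inl (algebraMap R (Localization.Away f) g) +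
    TrivSqZeroExt.inr (algebraMap R (Localization.Away f) (D g))
  map_one' := by ext <;> simp
  map_zero' := by ext <;> simp
  map_add' a b := by
    ext
    · simp
    · simp only [map_add, TrivSqZeroExt.snd_add, TrivSqZeroExt.snd_inl, TrivSqZeroExt.snd_inr]
      ring
  map_mul' a b := by
    ext
    · simp
    · simp only [map_add, map_mul, Derivation.leibniz, smul_eq_mul, TrivSqZeroExt.snd_add,
        TrivSqZeroExt.snd_inl, TrivSqZeroExt.snd_inr, TrivSqZeroExt.snd_mul,
        TrivSqZeroExt.fst_add, TrivSqZeroExt.fst_inl, TrivSqZeroExt.fst_inr,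
        MulOpposite.smul_eq_mul_unop, MulOpposite.unop_op]
      ring

theorem isUnit_toDual : IsUnit (toDual D f f) := by
  rw [TrivSqZeroExt.isUnit_iff_isUnit_fst]
  simpa [toDual] using IsLocalization.Away.algebraMap_isUnit (S := Localization.Away f) f

/-- The extension of `toDual` to `R[1/f]`. -/
def toDualAway : Localization.Away f →+*
    TrivSqZeroExt (Localization.Away f) (Localization.Away f) :=
  IsLocalization.Away.lift f (isUnit_toDual D f)

theorem toDualAway_algebraMap (a : R) :
    toDualAway D f (algebraMap R _ a) = toDual D f a :=
  IsLocalization.Away.lift_eq f (isUnit_toDual D f) a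

theorem fst_toDualAway (a : Localization.Away f) : (toDualAway D f a).fst = a := by
  have h : ((TrivSqZeroExt.fstHom (Localization.Away f) (Localization.Away f)
      (Localization.Away f)).toRingHom.comp (toDualAway D f)) = RingHom.id _ := by
    apply IsLocalization.ringHom_ext (Submonoid.powers f)
    ext a
    simp [toDualAway_algebraMap, toDual]
  exact congrArg (fun g => g a) h

/-- The derivation of `R[1/f]` that extends the derivation `D` of `R` (the quotient rule). -/
def extendAway : Derivation K (Localization.Away f) (Localization.Away f) :=
  Derivation.mk'
    { toFun := fun a => (toDualAway D f a).snd
      map_add' := fun a b => by simp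
      map_smul' := fun c a => by
        rw [Algebra.smul_def c a, IsScalarTower.algebraMap_apply K R, map_mul,
          TrivSqZeroExt.snd_mul, toDualAway_algebraMap, fst_toDualAway]
        simp [toDual, Algebra.smul_def, IsScalarTower.algebraMap_apply K R
          (Localization.Away f)] }
    (fun a b => by
      simp [TrivSqZeroExt.snd_mul, fst_toDualAway, mul_comm])

theorem extendAway_algebraMap (a : R) :
    extendAway D f (algebraMap R _ a) = algebraMap R _ (D a) := by
  change (toDualAway D f (algebraMap R _ a)).snd = _
  rw [toDualAway_algebraMap]
  simp only [toDual, RingHom.coe_mk, MonoidHom.coe_mk, OneHom.coe_mk, TrivSqZeroExt.snd_add,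
    TrivSqZeroExt.snd_inl, TrivSqZeroExt.snd_inr, zero_add]

theorem derivation_away_eq_zero (E : Derivation K (Localization.Away f) (Localization.Away f))
    (h : ∀ a : R, E (algebraMap R _ a) = 0) (y : Localization.Away f) : E y = 0 := by
  obtain ⟨⟨a, u⟩, hu⟩ := IsLocalization.surj (Submonoid.powers f) y
  have h1 := congrArg E hu
  simp only [Derivation.leibniz, h, smul_eq_mul, mul_zero, zero_add] at h1
  exact (IsLocalization.map_units (Localization.Away f) u).mul_right_eq_zero.mp h1

theorem extendAway_comm (D₁ D₂ : Derivation K R R) (h : ∀ a, D₁ (D₂ a) = D₂ (D₁ a))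
    (y : Localization.Away f) :
    extendAway D₁ f (extendAway D₂ f y) = extendAway D₂ f (extendAway D₁ f y) := by
  have := derivation_away_eq_zero f ⁅extendAway D₁ f, extendAway D₂ f⁆ (fun a => by
    simp [Derivation.commutator_apply, extendAway_algebraMap, h]) y
  rwa [Derivation.commutator_apply, sub_eq_zero] at this

/-- The logarithmic derivative `D(f)/f` in `R[1/f]`. -/
def logDer : Localization.Away f :=
  algebraMap R _ (D f) * IsLocalization.Away.invSelf f

theorem extendAway_logDer (D₁ D₂ : Derivation K R R) (h : ∀ a, D₁ (D₂ a) = D₂ (D₁ a)) :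
    extendAway D₁ f (logDer D₂ f) = extendAway D₂ f (logDer D₁ f) := by
  have hf := IsLocalization.Away.mul_invSelf (S := Localization.Away f) f
  have key : ∀ E : Derivation K R R, extendAway E f (IsLocalization.Away.invSelf f) =
      - (algebraMap R _ (E f)) * IsLocalization.Away.invSelf f ^ 2 := by
    intro E
    have h1 := congrArg (extendAway E f) hf
    simp only [Derivation.leibniz, smul_eq_mul, extendAway_algebraMap,
      Derivation.map_one_eq_zero] at h1
    linear_combination IsLocalization.Away.invSelf f * h1 -
      extendAway E f (IsLocalization.Away.invSelf f) * hf
  simp only [logDer, Derivation.leibniz, smul_eq_mul, extendAway_algebraMap, key, h]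
  ring

variable {A : Type*} [CommRing A] [Algebra K A]

theorem coeff_sum_monomial (E : Derivation K A A) (p : A[X]) (k : ℕ) :
    (∑ j ∈ p.support, monomial j (E (p.coeff j))).coeff k = E (p.coeff k) := by
  rw [finsetSum_coeff]
  simp only [coeff_monomial, Finset.sum_ite_eq', mem_support_iff]
  split_ifs with h
  · rfl
  · rw [notMem_support_iff.mp (by simpa using h), map_zero]

/-- A derivation of `A`, applied to the coefficients of a polynomial in `s` over `A`. -/
def coeffwise (E : Derivation K A A) : A[X] →ₗ[K] A[X] where
  toFun p := ∑ k ∈ p.support, monomial k (E (p.coeff k))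
  map_add' p q := by
    ext k
    rw [coeff_add, coeff_sum_monomial, coeff_sum_monomial, coeff_sum_monomial, coeff_add, map_add]
  map_smul' c p := by
    ext k
    rw [RingHom.id_apply, coeff_smul, coeff_sum_monomial, coeff_sum_monomial, coeff_smul, Derivation.map_smul]

theorem coeff_coeffwise (E : Derivation K A A) (p : A[X]) (k : ℕ) :
    (coeffwise E p).coeff k = E (p.coeff k) :=
  coeff_sum_monomial E p k

theorem coeffwise_C_mul (E : Derivation K A A) (a : A) (p : A[X]) :
    coeffwise E (C a * p) = C a * coeffwise E p + C (E a) * p := by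
  ext k
  simp [coeff_coeffwise, mul_comm]

theorem coeffwise_X_mul (E : Derivation K A A) (p : A[X]) :
    coeffwise E (X * p) = X * coeffwise E p := by
  ext k
  cases k <;> simp [coeff_coeffwise]

end Extend

/-! ### The module `M = R_n[s, 1/f] · f^s` -/

section Action

variable {K} (f : MvPolynomial (Fin n) K)

/-- The partial derivative `∂/∂x_i` on `R_n`. -/
abbrev pd (i : Fin n) : Derivation K (MvPolynomial (Fin n) K) (MvPolynomial (Fin n) K) :=
  MvPolynomial.pderiv i

theorem pd_comm (i j : Fin n) (a : MvPolynomial (Fin n) K) :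
    pd i (pd j a) = pd j (pd i a) := by
  have : ⁅(pd i : Derivation K (MvPolynomial (Fin n) K) (MvPolynomial (Fin n) K)),
      (pd j : Derivation K (MvPolynomial (Fin n) K) (MvPolynomial (Fin n) K))⁆ = 0 := by
    apply MvPolynomial.derivation_ext
    intro k
    simp only [Derivation.commutator_apply, MvPolynomial.pderiv_X, Pi.single_apply,
      Derivation.zero_apply]
    split_ifs <;> simp
  have h := congrArg (fun E => E a) this
  simpa [Derivation.commutator_apply, sub_eq_zero] using h

/-- The ring `R_n[s, 1/f]`, as polynomials in `s` over `R_n[1/f]`. -/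
abbrev Rfs : Type _ := (Localization.Away f)[X]

/-- The operator `x_i` on `M`, on coefficients of `f^s`: `g ↦ x_i g`. -/
def opX (i : Fin n) : Module.End K (Rfs f) :=
  LinearMap.mulLeft K (C (algebraMap (MvPolynomial (Fin n) K) (Localization.Away f)
    (MvPolynomial.X i)))

/-- The operator `∂_i` on `M`, on coefficients of `f^s`:
`g ↦ ∂g/∂x_i + s g (∂f/∂x_i) (1/f)`. -/
def opD (i : Fin n) : Module.End K (Rfs f) :=
  coeffwise (extendAway (pd i) f) + LinearMap.mulLeft K (X * C (logDer (pd i) f))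

/-- The operator `s` on `M`, on coefficients of `f^s`: `g ↦ s g`. -/
def opS : Module.End K (Rfs f) := LinearMap.mulLeft K X

theorem opX_apply (i : Fin n) (g : Rfs f) :
    opX f i g = C (algebraMap (MvPolynomial (Fin n) K) (Localization.Away f)
      (MvPolynomial.X i)) * g := rfl

theorem opD_apply (i : Fin n) (g : Rfs f) :
    opD f i g = coeffwise (extendAway (pd i) f) g + X * (C (logDer (pd i) f) * g) := by
  rw [← mul_assoc]
  rfl

theorem opS_apply (g : Rfs f) : opS f g = X * g := rfl

/-- The operators attached to the generators of the Weyl algebra. -/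
def opGen : Gen n → Module.End K (Rfs f)
  | Gen.x i => opX f i
  | Gen.d i => opD f i

theorem opX_comm (i j : Fin n) : opX f j * opX f i = opX f i * opX f j := by
  refine LinearMap.ext fun g => ?_
  simp only [Module.End.mul_apply, opX_apply]
  ring

theorem opD_comm (i j : Fin n) : opD f j * opD f i = opD f i * opD f j := by
  refine LinearMap.ext fun g => ?_
  have h1 := extendAway_logDer f (pd i) (pd j) (pd_comm i j)
  have h2 : coeffwise (extendAway (pd i) f) (coeffwise (extendAway (pd j) f) g) =
      coeffwise (extendAway (pd j) f) (coeffwise (extendAway (pd i) f) g) := by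
    ext k
    simp only [coeff_coeffwise]
    exact extendAway_comm f (pd i) (pd j) (pd_comm i j) _
  simp only [Module.End.mul_apply, opD_apply, map_add, coeffwise_X_mul, coeffwise_C_mul, h1, h2]
  ring

theorem opD_opX (i j : Fin n) :
    opD f i * opX f j = opX f j * opD f i + if i = j then 1 else 0 := by
  refine LinearMap.ext fun g => ?_
  simp only [Module.End.mul_apply, LinearMap.add_apply, opD_apply, opX_apply, coeffwise_C_mul,
    extendAway_algebraMap, MvPolynomial.pderiv_X, Pi.single_apply]
  by_cases h : i = j
  · subst h
    simp only [if_true, map_one, Module.End.one_apply]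
    ring
  · simp only [if_neg h, if_neg (Ne.symm h), map_zero, LinearMap.zero_apply]
    ring

/-- The action of the Weyl algebra on `M`. -/
def weylAction : Weyl K n →ₐ[K] Module.End K (Rfs f) :=
  Weyl.lift K (FreeAlgebra.lift K (opGen f)) (by
    intro a b h
    cases h with
    | xx i j => simpa [opGen] using opX_comm f i j
    | dd i j => simpa [opGen] using opD_comm f i j
    | dx i j =>
      have := opD_opX f i j
      split_ifs at this ⊢ <;> simpa [opGen] using this)

theorem weylAction_x (i : Fin n) : weylAction f (Weyl.x K i) = opX f i := by
  simp [weylAction, Weyl.x, Weyl.lift_mk, opGen]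

theorem weylAction_d (i : Fin n) : weylAction f (Weyl.d K i) = opD f i := by
  simp [weylAction, Weyl.d, Weyl.lift_mk, opGen]

theorem opD_opS (i : Fin n) : Commute (opD f i) (opS f) := by
  refine LinearMap.ext fun g => ?_
  simp only [Module.End.mul_apply, opD_apply, opS_apply, coeffwise_X_mul]
  ring

theorem opX_opS (i : Fin n) : Commute (opX f i) (opS f) := by
  refine LinearMap.ext fun g => ?_
  simp only [Module.End.mul_apply, opX_apply, opS_apply]
  ring

theorem weylAction_commute (P : Weyl K n) : Commute (weylAction f P) (opS f) := by
  obtain ⟨a, rfl⟩ := Weyl.mk_surjective K P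
  induction a using FreeAlgebra.induction with
  | grade0 r =>
    rw [AlgHom.commutes, AlgHom.commutes]
    exact Algebra.commutes r _
  | grade1 g =>
    cases g with
    | x i => exact (weylAction_x f i).symm ▸ opX_opS f i
    | d i => exact (weylAction_d f i).symm ▸ opD_opS f i
  | mul a b ha hb =>
    rw [map_mul, map_mul]
    exact ha.mul_left hb
  | add a b ha hb =>
    rw [map_add, map_add]
    exact ha.add_left hb

/-- The action of `D_n[s]` on `M`: the Weyl algebra acts as above and `s` by multiplication. -/
def action : WeylS K n →+* Module.End K (Rfs f) :=
  eval₂RingHom' (weylAction f).toRingHom (opS f) (weylAction_commute f)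

/-- The left `D_n[s]`-module `M = R_n[s, 1/f] · f^s`, free of rank one over `R_n[s, 1/f]`: the
element `g · f^s` is represented by its coefficient `g`. -/
def FsModule : Type _ := Rfs f

instance : AddCommGroup (FsModule f) := inferInstanceAs (AddCommGroup (Rfs f))

instance : Module (Module.End K (Rfs f)) (FsModule f) :=
  inferInstanceAs (Module (Module.End K (Rfs f)) (Rfs f))

instance : Module (WeylS K n) (FsModule f) := Module.compHom (FsModule f) (action f)

/-- The generator `f^s` of `M`. -/
def fs : FsModule f := (1 : Rfs f)

theorem smul_fs (P : WeylS K n) : P • fs f = action f P 1 := rfl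

/-- The annihilator of `f^s` in `D_n[s]`, a left ideal. -/
def annFs : Ideal (WeylS K n) := Ideal.torsionOf (WeylS K n) (FsModule f) (fs f)

/-- `b(s)` satisfies Bernstein's functional equation: `P(s) f · f^s = b(s) · f^s` for some
`P(s)` in `D_n[s]`. -/
def SatisfiesFunctionalEquation (b : K[X]) : Prop :=
  ∃ P : WeylS K n, (P * WeylS.ofPoly K f) • fs f = (WeylS.ofKs K b : WeylS K n) • fs f

/-- `b` is a monic polynomial of minimal degree among those that satisfy Bernstein's
functional equation. -/
def IsBernsteinSato (b : K[X]) : Prop :=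
  b.Monic ∧ SatisfiesFunctionalEquation f b ∧
    ∀ c : K[X], c.Monic → SatisfiesFunctionalEquation f c → b.natDegree ≤ c.natDegree

variable {f} in
theorem SatisfiesFunctionalEquation.C_mul_sub {b c : K[X]}
    (hb : SatisfiesFunctionalEquation f b) (hc : SatisfiesFunctionalEquation f c) (a : K) :
    SatisfiesFunctionalEquation f (C a * (b - c)) := by
  obtain ⟨P, hP⟩ := hb
  obtain ⟨Q, hQ⟩ := hc
  refine ⟨WeylS.ofKs K (C a) * (P - Q), ?_⟩
  rw [mul_assoc, sub_mul, map_mul, map_sub, mul_smul, mul_smul, sub_smul, sub_smul, hP, hQ]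

variable {f} in
/-- There is at most one Bernstein-Sato polynomial. -/
theorem IsBernsteinSato.unique {b c : K[X]} (hb : IsBernsteinSato f b)
    (hc : IsBernsteinSato f c) : b = c := by
  obtain ⟨hb1, hb2, hb3⟩ := hb
  obtain ⟨hc1, hc2, hc3⟩ := hc
  by_contra hne
  have h0 : b - c ≠ 0 := sub_ne_zero.mpr hne
  have hdeg : b.degree = c.degree := by
    rw [degree_eq_natDegree hb1.ne_zero, degree_eq_natDegree hc1.ne_zero,
      le_antisymm (hb3 c hc1 hc2) (hc3 b hb1 hb2)]
  have hlt : (b - c).degree < b.degree :=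
    degree_sub_lt_left hdeg hb1.ne_zero (by rw [hb1.leadingCoeff, hc1.leadingCoeff])
  have hm : (C (b - c).leadingCoeff⁻¹ * (b - c)).Monic := by
    rw [mul_comm]
    exact monic_mul_leadingCoeff_inv h0
  have h3 := hb3 _ hm (hb2.C_mul_sub hc2 _)
  rw [natDegree_C_mul (inv_ne_zero (leadingCoeff_ne_zero.mpr h0))] at h3
  exact absurd (natDegree_lt_natDegree h0 hlt) (not_lt.mpr h3)

open Classical in
/-- The Bernstein-Sato polynomial `b_f(s)`: the monic polynomial of minimal degree that satisfies
Bernstein's functional equation (the value `0` is never taken for `f ≠ 0` in characteristic `0`,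
by Bernstein's theorem). -/
def bernsteinSato : K[X] :=
  if h : ∃ b, IsBernsteinSato f b then h.choose else 0

end Action

end WeylBS

end

/-! Let `J` be the left ideal `ann(f^s) + D_n[s] f`. A polynomial `b(s)` satisfies the functional
equation exactly when it lies in `J`, so `b_f` is the monic element of least degree in `J ∩ K[s]`.
Two facts about the central element `s + α` give the equivalence of 1 and 2
(`isRoot_bernsteinSato_iff`). If `b_f(-α) ≠ 0`, then `b_f` is a unit modulo `s + α`, so `J` and `s +
α` generate everything. If `b_f = (s + α) c` and `J` and `s + α` generate everything, then `s + α`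
can be cancelled and `c` lies in `J`, against minimality. The equivalence of 2 and 3 is the
identification of `D_n[s]` modulo `s + α` with `D_n` (`span_specialize_eq_top_iff`). The final
equality holds because `s + α` is maximal in `K[s]` and the ideal is proper.

All of this presupposes that `b_f` exists, and most of the work is Bernstein's theorem. Over the
field `K(s)`, the module `M` has a filtration by pole order and degree whose dimensions grow at most
like `k ^ n`. Bernstein's inequality says that a nonzero module with operators satisfying the Weyl
relations has filtrations growing at least like `k ^ n`, in the form of a bound `m ^ (2n) ≤ dim
N(2nm) * dim N(4nm)` with a constant independent of the module. Hence the chain of submodules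
generated by `f^j · f^s` can have only boundedly many strict steps. Clearing denominators gives
`P(s) f^(j+1) · f^s = b(s) f^j · f^s` with `b ≠ 0` (`exists_functionalEquation_pow`), and the
substitution `s ↦ s - 1`, applied `j` times, turns this into a functional equation for `f` itself.
-/

noncomputable section

namespace WeylBS

/-! ### Families of operators satisfying the Weyl relations -/

section CommEval

variable {F E ι : Type*} [CommRing F] [Ring E] [Algebra F E]

/-- Evaluation of multivariate polynomials at a family of commuting elements of a
(noncommutative) algebra. -/
def commEval (T : ι → E) (hT : ∀ i j, T i * T j = T j * T i) : MvPolynomial ι F →ₐ[F] E :=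
  letI : CommRing (Algebra.adjoin F (Set.range T)) :=
    { (inferInstance : Ring (Algebra.adjoin F (Set.range T))) with
      mul_comm := by
        have := Algebra.isMulCommutative_adjoin F (s := Set.range T) (by
          rintro _ ⟨i, rfl⟩ _ ⟨j, rfl⟩
          exact hT i j)
        exact fun a b => mul_comm' a b }
  (Algebra.adjoin F (Set.range T)).val.comp
    (MvPolynomial.aeval fun i => ⟨T i, Algebra.subset_adjoin ⟨i, rfl⟩⟩)

theorem commEval_X (T : ι → E) (hT : ∀ i j, T i * T j = T j * T i) (i : ι) :
    commEval (F := F) T hT (MvPolynomial.X i) = T i := by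
  simp [commEval]

theorem commute_commEval (T : ι → E) (hT : ∀ i j, T i * T j = T j * T i) {y : E}
    (h : ∀ i, Commute y (T i)) (p : MvPolynomial ι F) : Commute y (commEval T hT p) := by
  induction p using MvPolynomial.induction_on with
  | C a =>
    rw [MvPolynomial.C_eq_smul_one, map_smul, map_one]
    exact (Commute.one_right y).smul_right a
  | add p q hp hq =>
    rw [map_add]
    exact hp.add_right hq
  | mul_X p i hp =>
    rw [map_mul, commEval_X]
    exact hp.mul_right (h i)

/-- If `[y, T k] = 1` and `y` commutes with the other `T i`, then the commutator with `y` acts on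
polynomials in the family `T` as the partial derivative with respect to the `k`-th variable. -/
theorem commutator_commEval [DecidableEq ι] (T : ι → E) (hT : ∀ i j, T i * T j = T j * T i) {y : E}
    (k : ι) (h : ∀ i, y * T i = T i * y + if k = i then 1 else 0) (p : MvPolynomial ι F) :
    y * commEval T hT p =
      commEval T hT p * y + commEval T hT (MvPolynomial.pderiv k p) := by
  induction p using MvPolynomial.induction_on with
  | C a =>
    simp [MvPolynomial.C_eq_smul_one]
  | add p q hp hq =>
    simp only [map_add, mul_add, add_mul, hp, hq]
    abel
  | mul_X p i hp =>
    rw [map_mul, commEval_X, ← mul_assoc, hp, add_mul, mul_assoc _ y, h, MvPolynomial.pderiv_mul,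
      MvPolynomial.pderiv_X, Pi.single_apply]
    simp only [map_add, map_mul, commEval_X, mul_add, ← mul_assoc]
    by_cases hki : k = i
    · subst hki
      simp only [if_true, map_one, mul_one]
      abel
    · simp [hki, Ne.symm hki]

end CommEval

/-- Operators `X i`, `D i` on a module that satisfy the relations of the Weyl algebra. -/
structure WeylOps (F V : Type*) [CommRing F] [AddCommGroup V] [Module F V] (n : ℕ) where
  X : Fin n → Module.End F V
  D : Fin n → Module.End F V
  X_comm : ∀ i j, X i * X j = X j * X i
  D_comm : ∀ i j, D i * D j = D j * D i
  D_X : ∀ i j, D i * X j = X j * D i + if i = j then 1 else 0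

namespace WeylOps

/-! ### Normally ordered operators and their symbols. -/

section Basic

variable {F V : Type*} [CommRing F] [AddCommGroup V] [Module F V] {n : ℕ} (T : WeylOps F V n)

/-- A filtration is compatible with the operators if these raise the index by at most one. -/
def Compatible (N : ℕ → Submodule F V) : Prop :=
  Monotone N ∧ ∀ i k, N k ≤ (N (k + 1)).comap (T.X i) ∧ N k ≤ (N (k + 1)).comap (T.D i)

/-- A submodule is stable if it is preserved by the operators. -/
def Stable (W : Submodule F V) : Prop :=
  ∀ i, W ≤ W.comap (T.X i) ∧ W ≤ W.comap (T.D i)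

/-- Normally ordered evaluation: `x^a ξ^b ↦ X^a D^b`. -/
def normalOrder : MvPolynomial (Fin n ⊕ Fin n) F →ₗ[F] Module.End F V :=
  (MvPolynomial.basisMonomials (Fin n ⊕ Fin n) F).constr F fun e =>
    commEval (F := F) T.X T.X_comm
        (MvPolynomial.monomial (Finsupp.sumFinsuppEquivProdFinsupp e).1 1) *
      commEval (F := F) T.D T.D_comm
        (MvPolynomial.monomial (Finsupp.sumFinsuppEquivProdFinsupp e).2 1)

theorem normalOrder_monomial (e : (Fin n ⊕ Fin n) →₀ ℕ) :
    T.normalOrder (MvPolynomial.monomial e 1) =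
      commEval (F := F) T.X T.X_comm
          (MvPolynomial.monomial (Finsupp.sumFinsuppEquivProdFinsupp e).1 1) *
        commEval (F := F) T.D T.D_comm
          (MvPolynomial.monomial (Finsupp.sumFinsuppEquivProdFinsupp e).2 1) := by
  have h := (MvPolynomial.basisMonomials (Fin n ⊕ Fin n) F).constr_basis F (fun e =>
    commEval (F := F) T.X T.X_comm
        (MvPolynomial.monomial (Finsupp.sumFinsuppEquivProdFinsupp e).1 1) *
      commEval (F := F) T.D T.D_comm
        (MvPolynomial.monomial (Finsupp.sumFinsuppEquivProdFinsupp e).2 1)) e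
  rwa [MvPolynomial.coe_basisMonomials] at h

theorem monomial_sum_eq (e : (Fin n ⊕ Fin n) →₀ ℕ) :
    (MvPolynomial.monomial e 1 : MvPolynomial (Fin n ⊕ Fin n) F) =
      MvPolynomial.rename Sum.inl
          (MvPolynomial.monomial (Finsupp.sumFinsuppEquivProdFinsupp e).1 1) *
        MvPolynomial.rename Sum.inr
          (MvPolynomial.monomial (Finsupp.sumFinsuppEquivProdFinsupp e).2 1) := by
  rw [MvPolynomial.rename_monomial, MvPolynomial.rename_monomial, MvPolynomial.monomial_mul,
    mul_one]
  refine congrArg (fun d => MvPolynomial.monomial d (1 : F)) (Finsupp.ext ?_)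
  rintro (i | i)
  · rw [Finsupp.add_apply, Finsupp.mapDomain_apply Sum.inl_injective,
      Finsupp.mapDomain_of_notMem_range _ _ (by simp)]
    simp
  · rw [Finsupp.add_apply, Finsupp.mapDomain_apply Sum.inr_injective,
      Finsupp.mapDomain_of_notMem_range _ _ (by simp)]
    simp

/-- Both sides are bilinear in `g` and `h`, so the defining values on monomials suffice. This frees
later arguments from exponent vectors. -/
theorem normalOrder_mul (g h : MvPolynomial (Fin n) F) :
    T.normalOrder (MvPolynomial.rename Sum.inl g * MvPolynomial.rename Sum.inr h) =
      commEval T.X T.X_comm g * commEval T.D T.D_comm h := by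
  induction g using MvPolynomial.induction_on' with
  | add p q hp hq => simp only [map_add, add_mul, hp, hq]
  | monomial a r =>
    induction h using MvPolynomial.induction_on' with
    | add p q hp hq => simp only [map_add, mul_add, hp, hq]
    | monomial b c =>
      have hm := monomial_sum_eq (F := F) (Finsupp.sumFinsuppEquivProdFinsupp.symm (a, b))
      have h1 := T.normalOrder_monomial (Finsupp.sumFinsuppEquivProdFinsupp.symm (a, b))
      rw [hm, Equiv.apply_symm_apply] at h1
      have ha : MvPolynomial.monomial a r = r • (MvPolynomial.monomial a 1 : MvPolynomial (Fin n) F) := by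
        rw [MvPolynomial.smul_monomial, smul_eq_mul, mul_one]
      have hb : MvPolynomial.monomial b c = c • (MvPolynomial.monomial b 1 : MvPolynomial (Fin n) F) := by
        rw [MvPolynomial.smul_monomial, smul_eq_mul, mul_one]
      rw [ha, hb]
      simp only [map_smul, smul_mul_assoc, mul_smul_comm, h1]

theorem normalOrder_one : T.normalOrder 1 = 1 := by
  have := T.normalOrder_mul 1 1
  simpa using this

/-- Products `g(x) h(ξ)` span all symbols, so linear identities need only be checked on them. -/
theorem normalOrder_induction {p : MvPolynomial (Fin n ⊕ Fin n) F → Prop}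
    (hadd : ∀ a b, p a → p b → p (a + b)) (hsmul : ∀ (c : F) a, p a → p (c • a))
    (hmul : ∀ g h : MvPolynomial (Fin n) F,
      p (MvPolynomial.rename Sum.inl g * MvPolynomial.rename Sum.inr h)) (a) : p a := by
  induction a using MvPolynomial.induction_on' with
  | add a b ha hb => exact hadd _ _ ha hb
  | monomial e r =>
    have : MvPolynomial.monomial e r =
        r • (MvPolynomial.monomial e 1 : MvPolynomial (Fin n ⊕ Fin n) F) := by
      rw [MvPolynomial.smul_monomial, smul_eq_mul, mul_one]
    rw [this, monomial_sum_eq]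
    exact hsmul _ _ (hmul _ _)

theorem pderiv_inl_rename_inr (i : Fin n) (h : MvPolynomial (Fin n) F) :
    MvPolynomial.pderiv (Sum.inl i : Fin n ⊕ Fin n) (MvPolynomial.rename Sum.inr h) = 0 := by
  classical
  apply MvPolynomial.pderiv_eq_zero_of_notMem_vars
  intro hi
  have := MvPolynomial.vars_rename Sum.inr h hi
  simp at this

theorem pderiv_inr_rename_inl (i : Fin n) (h : MvPolynomial (Fin n) F) :
    MvPolynomial.pderiv (Sum.inr i : Fin n ⊕ Fin n) (MvPolynomial.rename Sum.inl h) = 0 := by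
  classical
  apply MvPolynomial.pderiv_eq_zero_of_notMem_vars
  intro hi
  have := MvPolynomial.vars_rename Sum.inl h hi
  simp at this

/-- `D i` commutes with the `D`-part of a normally ordered product and differentiates the `X`-part,
so commutation with it lowers the degree of the symbol. -/
theorem D_mul_normalOrder (i : Fin n) (p : MvPolynomial (Fin n ⊕ Fin n) F) :
    T.D i * T.normalOrder p =
      T.normalOrder p * T.D i + T.normalOrder (MvPolynomial.pderiv (Sum.inl i) p) := by
  induction p using normalOrder_induction with
  | hadd a b ha hb =>
    simp only [map_add, mul_add, add_mul, ha, hb]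
    abel
  | hsmul c a ha => simp only [Derivation.map_smul, map_smul, smul_mul_assoc, mul_smul_comm, ha,
      smul_add]
  | hmul g h =>
    rw [MvPolynomial.pderiv_mul, pderiv_inl_rename_inr, mul_zero, add_zero,
      MvPolynomial.pderiv_rename Sum.inl_injective, T.normalOrder_mul, T.normalOrder_mul,
      ← mul_assoc, commutator_commEval T.X T.X_comm i (T.D_X i), add_mul, mul_assoc, mul_assoc,
      (commute_commEval T.D T.D_comm (fun j => T.D_comm i j) h).eq]

theorem X_mul_normalOrder (i : Fin n) (p : MvPolynomial (Fin n ⊕ Fin n) F) :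
    T.normalOrder p * T.X i =
      T.X i * T.normalOrder p + T.normalOrder (MvPolynomial.pderiv (Sum.inr i) p) := by
  induction p using normalOrder_induction with
  | hadd a b ha hb =>
    simp only [map_add, mul_add, add_mul, ha, hb]
    abel
  | hsmul c a ha => simp only [Derivation.map_smul, map_smul, smul_mul_assoc, mul_smul_comm, ha,
      smul_add]
  | hmul g h =>
    -- The roles of the two families are exchanged: `-X i` has commutator `1` with `D i` and
    -- commutes with the other `D j`.
    have hX := commutator_commEval (F := F) T.D T.D_comm (y := -T.X i) i (fun j => by
      have := T.D_X j i
      rw [mul_neg, this, neg_mul]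
      simp only [eq_comm (a := i)]
      abel) h
    rw [MvPolynomial.pderiv_mul, pderiv_inr_rename_inl, zero_mul, zero_add,
      MvPolynomial.pderiv_rename Sum.inr_injective, T.normalOrder_mul, T.normalOrder_mul,
      ← mul_assoc, (commute_commEval T.X T.X_comm (fun j => T.X_comm i j) g).eq, mul_assoc,
      mul_assoc, ← mul_add]
    congr 1
    rw [mul_neg, neg_mul, neg_eq_iff_eq_neg] at hX
    rw [hX]
    abel

theorem commEval_monomial_mem {N : ℕ → Submodule F V} (Y : Fin n → Module.End F V)
    (hY : ∀ i j, Y i * Y j = Y j * Y i) (h : ∀ i k, N k ≤ (N (k + 1)).comap (Y i))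
    (a : Fin n →₀ ℕ) (k : ℕ) (v : V) (hv : v ∈ N k) :
    commEval (F := F) Y hY (MvPolynomial.monomial a 1) v ∈ N (k + a.degree) := by
  induction a using Finsupp.induction_linear generalizing k v with
  | zero =>
    rw [show (MvPolynomial.monomial 0 1 : MvPolynomial (Fin n) F) = 1 from rfl]
    simpa using hv
  | add a b ha hb =>
    rw [← mul_one (1 : F), ← MvPolynomial.monomial_mul, map_mul, Module.End.mul_apply,
      map_add, add_comm a.degree, ← add_assoc]
    exact ha _ _ (hb k v hv)
  | single i m =>
    rw [← MvPolynomial.X_pow_eq_monomial, map_pow, commEval_X, Finsupp.degree_single]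
    induction m with
    | zero => simpa using hv
    | succ m ih =>
      rw [pow_succ', Module.End.mul_apply]
      exact h i _ ih

theorem degree_sum_eq {α β : Type*} [Fintype α] [Fintype β] (e : (α ⊕ β) →₀ ℕ) :
    e.degree = (Finsupp.sumFinsuppEquivProdFinsupp e).1.degree +
      (Finsupp.sumFinsuppEquivProdFinsupp e).2.degree := by
  rw [Finsupp.degree_eq_sum, Finsupp.degree_eq_sum, Finsupp.degree_eq_sum, Fintype.sum_sum_type]
  simp only [Finsupp.fst_sumFinsuppEquivProdFinsupp, Finsupp.snd_sumFinsuppEquivProdFinsupp]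

variable {T} in
theorem Compatible.normalOrder_monomial_mem {N : ℕ → Submodule F V} (hN : T.Compatible N)
    (e : (Fin n ⊕ Fin n) →₀ ℕ) {k l : ℕ} (hl : k + e.degree ≤ l) {v : V} (hv : v ∈ N k) :
    T.normalOrder (MvPolynomial.monomial e 1) v ∈ N l := by
  rw [degree_sum_eq] at hl
  rw [normalOrder_monomial, Module.End.mul_apply]
  generalize (Finsupp.sumFinsuppEquivProdFinsupp e).1 = a at *
  generalize (Finsupp.sumFinsuppEquivProdFinsupp e).2 = b at *
  refine hN.1 (show k + b.degree + a.degree ≤ l by omega) ?_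
  refine commEval_monomial_mem T.X T.X_comm (fun i k => (hN.2 i k).1) a _ _ ?_
  exact commEval_monomial_mem T.D T.D_comm (fun i k => (hN.2 i k).2) b _ _ hv

end Basic

/-- If `m i ≠ 0`, then `m i` times the coefficient of `m` is a coefficient of the `i`-th derivative,
and `m i` is invertible in characteristic zero. -/
theorem eq_C_of_pderiv_eq_zero {F σ : Type*} [Field F] [CharZero F] {p : MvPolynomial σ F}
    (h : ∀ i, MvPolynomial.pderiv i p = 0) : p = MvPolynomial.C (p.coeff 0) := by
  classical
  ext m
  rw [MvPolynomial.coeff_C]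
  split_ifs with hm
  · rw [hm]
  · obtain ⟨i, hi⟩ : ∃ i, m i ≠ 0 := by
      by_contra! hc
      exact hm (Finsupp.ext fun i => (hc i).symm)
    have h1 := congrArg (MvPolynomial.coeff (m - Finsupp.single i 1)) (h i)
    rw [MvPolynomial.coeff_pderiv, tsub_add_cancel_of_le (by simpa using Nat.one_le_iff_ne_zero.mpr hi)] at h1
    simp only [MvPolynomial.coeff_zero, mul_eq_zero] at h1
    refine h1.resolve_right ?_
    exact Nat.cast_add_one_ne_zero _

theorem totalDegree_pderiv_le {F σ : Type*} [Field F] (i : σ) (p : MvPolynomial σ F) :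
    (MvPolynomial.pderiv i p).totalDegree ≤ p.totalDegree - 1 := by
  rw [MvPolynomial.totalDegree, Finset.sup_le_iff]
  intro m hm
  rw [MvPolynomial.mem_support_iff, MvPolynomial.coeff_pderiv] at hm
  have h := MvPolynomial.le_totalDegree (MvPolynomial.mem_support_iff.mpr (left_ne_zero_of_mul hm))
  rw [Finsupp.sum_add_index' (fun _ => rfl) (fun _ _ _ => rfl), Finsupp.sum_single_index rfl] at h
  omega

/-! ### Bernstein's inequality. -/

section Field

variable {F V : Type*} [Field F] [CharZero F] [AddCommGroup V] [Module F V] {n : ℕ}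
  {T : WeylOps F V n}

/-- A normally ordered operator of degree at most `k` that vanishes on the `k`-th step of a
filtration with `N 0 ≠ 0` is zero. -/
theorem Compatible.eq_zero_of_normalOrder {N : ℕ → Submodule F V} (hN : T.Compatible N)
    (h0 : N 0 ≠ ⊥) (k : ℕ) (p : MvPolynomial (Fin n ⊕ Fin n) F) (hp : p.totalDegree ≤ k)
    (h : ∀ v ∈ N k, T.normalOrder p v = 0) : p = 0 := by
  -- A constant symbol acts as a scalar, and a scalar that kills a nonzero vector of `N 0` is zero.
  have hconst : ∀ (k : ℕ) (q : MvPolynomial (Fin n ⊕ Fin n) F),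
      (∀ v ∈ N k, T.normalOrder q v = 0) → q = MvPolynomial.C (q.coeff 0) → q = 0 := by
    intro k q hq hC
    obtain ⟨v, hv, hv0⟩ := Submodule.exists_mem_ne_zero_of_ne_bot h0
    have h1 := hq v (hN.1 (Nat.zero_le k) hv)
    rw [hC, MvPolynomial.C_eq_smul_one, map_smul, normalOrder_one, LinearMap.smul_apply,
      Module.End.one_apply, smul_eq_zero] at h1
    rw [hC, h1.resolve_right hv0, map_zero]
  induction k generalizing p with
  | zero =>
    exact hconst 0 p h (MvPolynomial.totalDegree_eq_zero_iff_eq_C.mp (Nat.le_zero.mp hp))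
  | succ k ih =>
    refine hconst _ p h (eq_C_of_pderiv_eq_zero fun i => ?_)
    -- For `v` in `N k`, the operator kills both `v` and its image under `D i` or `X i`, which lies
    -- in `N (k + 1)`. So the commutator, whose symbol is a partial derivative of `p`, kills `N k`.
    refine ih _ ((totalDegree_pderiv_le i p).trans (by omega)) fun v hv => ?_
    have hv' := hN.1 (Nat.le_succ k) hv
    rcases i with i | i
    · have h1 := congrArg (fun A => A v) (T.D_mul_normalOrder i p)
      simpa [h v hv', h _ ((hN.2 i k).2 hv)] using h1.symm
    · have h1 := congrArg (fun A => A v) (T.X_mul_normalOrder i p)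
      simpa [h v hv', h _ ((hN.2 i k).1 hv)] using h1.symm

/-- Bernstein's inequality, in a crude quantitative form. -/
theorem Compatible.pow_le_finrank_mul_finrank {N : ℕ → Submodule F V} (hN : T.Compatible N)
    (h0 : N 0 ≠ ⊥) [∀ k, FiniteDimensional F (N k)] (m : ℕ) :
    m ^ (2 * n) ≤ Module.finrank F (N (2 * n * m)) * Module.finrank F (N (4 * n * m)) := by
  -- There are `m ^ (2n)` monomials in `2n` variables with all exponents below `m`, each of degree
  -- at most `2nm`. Their operators map `N (2nm)` to `N (4nm)` and are independent there, so the
  -- dimension of the Hom space bounds their number.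
  set k := 2 * n * m with hk
  set expo : ((Fin n ⊕ Fin n) → Fin m) → ((Fin n ⊕ Fin n) →₀ ℕ) :=
    fun e => Finsupp.equivFunOnFinite.symm fun i => (e i : ℕ) with hexpo
  have hinj : Function.Injective expo := by
    intro e e' h
    funext i
    exact Fin.ext (congrArg (fun g => g i) h)
  have hdeg : ∀ e, (expo e).degree ≤ k := by
    intro e
    rw [Finsupp.degree_eq_sum]
    refine (Finset.sum_le_card_nsmul _ _ m fun i _ => (e i).2.le).trans ?_
    simp only [Finset.card_univ, Fintype.card_sum, Fintype.card_fin, smul_eq_mul, hk]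
    rw [two_mul]
  let L : ((Fin n ⊕ Fin n) → Fin m) → (N k →ₗ[F] N (4 * n * m)) := fun e =>
    (T.normalOrder (MvPolynomial.monomial (expo e) 1)).restrict fun v hv =>
      hN.normalOrder_monomial_mem (expo e) (by have := hdeg e; rw [hk] at *; linarith) hv
  have hL : LinearIndependent F L := by
    rw [Fintype.linearIndependent_iff]
    intro c hc
    have hz : (∑ e, MvPolynomial.monomial (expo e) (c e) :
        MvPolynomial (Fin n ⊕ Fin n) F) = 0 := by
      refine hN.eq_zero_of_normalOrder h0 k _ ?_ ?_
      · refine MvPolynomial.totalDegree_finsetSum_le fun e _ => ?_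
        refine (MvPolynomial.totalDegree_monomial_le _ _).trans (hdeg e)
      · intro v hv
        have h1 := congrArg (fun A => ((A ⟨v, hv⟩ : N (4 * n * m)) : V)) hc
        simp only [LinearMap.sum_apply, LinearMap.smul_apply, Submodule.coe_sum,
          Submodule.coe_smul, LinearMap.zero_apply, Submodule.coe_zero] at h1
        rw [map_sum, LinearMap.sum_apply, ← h1]
        refine Finset.sum_congr rfl fun e _ => ?_
        rw [show MvPolynomial.monomial (expo e) (c e) = c e •
            (MvPolynomial.monomial (expo e) 1 : MvPolynomial (Fin n ⊕ Fin n) F) by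
          rw [MvPolynomial.smul_monomial, smul_eq_mul, mul_one], map_smul]
        rfl
    intro e
    have h1 := congrArg (MvPolynomial.coeff (expo e)) hz
    simpa [MvPolynomial.coeff_sum, MvPolynomial.coeff_monomial, hinj.eq_iff] using h1
  have := hL.fintype_card_le_finrank
  rw [Module.finrank_linearMap] at this
  simpa [← two_mul] using this

end Field

/-! ### Induced operators and filtrations on subquotients. -/

section Quotient

variable {F V : Type*} [CommRing F] [AddCommGroup V] [Module F V] {n : ℕ} (T : WeylOps F V n)

/-- The operators induced on the quotient by a stable submodule. -/
def quotient (W : Submodule F V) (hW : T.Stable W) : WeylOps F (V ⧸ W) n where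
  X i := W.mapQ W (T.X i) (hW i).1
  D i := W.mapQ W (T.D i) (hW i).2
  X_comm i j := by
    refine Submodule.linearMap_qext _ (LinearMap.ext fun v => ?_)
    exact congrArg (fun A => W.mkQ (A v)) (T.X_comm i j)
  D_comm i j := by
    refine Submodule.linearMap_qext _ (LinearMap.ext fun v => ?_)
    exact congrArg (fun A => W.mkQ (A v)) (T.D_comm i j)
  D_X i j := by
    refine Submodule.linearMap_qext _ (LinearMap.ext fun v => ?_)
    have := congrArg (fun A => W.mkQ (A v)) (T.D_X i j)
    split_ifs at this ⊢ <;> exact this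

variable {T}

theorem Compatible.inf {Γ : ℕ → Submodule F V} (hΓ : T.Compatible Γ) {W : Submodule F V}
    (hW : T.Stable W) : T.Compatible fun k => Γ k ⊓ W :=
  ⟨fun _ _ h => inf_le_inf_right W (hΓ.1 h), fun i k =>
    ⟨fun _ hv => ⟨(hΓ.2 i k).1 hv.1, (hW i).1 hv.2⟩,
      fun _ hv => ⟨(hΓ.2 i k).2 hv.1, (hW i).2 hv.2⟩⟩⟩

theorem Compatible.shift {Γ : ℕ → Submodule F V} (hΓ : T.Compatible Γ) (κ : ℕ) :
    T.Compatible fun k => Γ (κ + k) :=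
  ⟨fun _ _ h => hΓ.1 (by omega), fun i k => hΓ.2 i (κ + k)⟩

theorem Compatible.map_mkQ {Γ : ℕ → Submodule F V} (hΓ : T.Compatible Γ) {W : Submodule F V}
    (hW : T.Stable W) : (T.quotient W hW).Compatible fun k => (Γ k).map W.mkQ := by
  refine ⟨fun _ _ h => Submodule.map_mono (hΓ.1 h), fun i k => ⟨?_, ?_⟩⟩
  · rintro _ ⟨v, hv, rfl⟩
    exact ⟨T.X i v, (hΓ.2 i k).1 hv, rfl⟩
  · rintro _ ⟨v, hv, rfl⟩
    exact ⟨T.D i v, (hΓ.2 i k).2 hv, rfl⟩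

end Quotient

/-! ### Counting dimensions along a descending chain. -/

section Counting

variable {F V : Type*} [Field F] [AddCommGroup V] [Module F V] {n : ℕ} {T : WeylOps F V n}

theorem finrank_map_mkQ_add (U W : Submodule F V) [FiniteDimensional F U] :
    Module.finrank F (U.map W.mkQ) + Module.finrank F (U ⊓ W : Submodule F V) =
      Module.finrank F U := by
  have h := (W.mkQ.domRestrict U).finrank_range_add_finrank_ker
  rw [LinearMap.range_domRestrict, LinearMap.ker_domRestrict, Submodule.ker_mkQ] at h
  rw [← h, ← Submodule.map_comap_subtype, Submodule.finrank_map_subtype_eq]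

/-- The summands are the dimensions of the successive quotients of the chain `U ⊓ W j`, so the sum
telescopes. -/
theorem sum_finrank_map_mkQ_le {W : ℕ → Submodule F V} (hW : Antitone W) (U : Submodule F V)
    [FiniteDimensional F U] (r : ℕ) :
    ∑ j ∈ Finset.range r,
        Module.finrank F ((U ⊓ W j : Submodule F V).map (W (j + 1)).mkQ) +
      Module.finrank F (U ⊓ W r : Submodule F V) ≤ Module.finrank F U := by
  induction r with
  | zero => simpa using Submodule.finrank_mono (inf_le_left : U ⊓ W 0 ≤ U)
  | succ r ih =>
    have h := finrank_map_mkQ_add (U ⊓ W r) (W (r + 1))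
    rw [inf_assoc, inf_eq_right.mpr (hW (Nat.le_succ r))] at h
    rw [Finset.sum_range_succ]
    rw [Nat.succ_eq_add_one] at h
    omega

variable [CharZero F]

/-- In a module with a filtration whose dimensions grow at most like `k ^ n`, a descending chain of
stable subspaces generated by elements `u j` becomes stationary. -/
theorem Compatible.exists_mem_succ {Γ : ℕ → Submodule F V} (hΓ : T.Compatible Γ)
    [∀ k, FiniteDimensional F (Γ k)] (c : ℕ)
    (hc : ∀ k, Module.finrank F (Γ k) ≤ (c * (k + 1)) ^ n)
    {W : ℕ → Submodule F V} (hW : Antitone W) (hWs : ∀ j, T.Stable (W j)) {u : ℕ → V}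
    (huW : ∀ j, u j ∈ W j) (huΓ : ∀ j, ∃ k, u j ∈ Γ k) : ∃ j, u j ∈ W (j + 1) := by
  by_contra! hcon
  choose κ' hκ' using huΓ
  -- One more than the number of strict steps that the final estimate allows.
  set r := (c * (4 * n + 1)) ^ (2 * n) + 1 with hr
  -- Starting the filtration at `Γ κ` puts all of `u 0, …, u (r - 1)` into its zeroth step, so each
  -- of the first `r` subquotients has a nonzero zeroth step, as Bernstein's inequality requires.
  set κ := (Finset.range r).sup κ' with hκ
  set m := κ + 1 with hm
  set N : ∀ j, ℕ → Submodule F (V ⧸ W (j + 1)) :=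
    fun j k => (Γ (κ + k) ⊓ W j).map (W (j + 1)).mkQ with hN
  have hNc : ∀ j, (T.quotient _ (hWs (j + 1))).Compatible (N j) := fun j =>
    Compatible.map_mkQ ((hΓ.shift κ).inf (hWs j)) (hWs (j + 1))
  have hfin : ∀ j k, FiniteDimensional F (N j k) := fun j k => inferInstance
  have hN0 : ∀ j ∈ Finset.range r, N j 0 ≠ ⊥ := by
    intro j hj h
    have h1 : (W (j + 1)).mkQ (u j) ∈ N j 0 :=
      ⟨u j, ⟨hΓ.1 (by simpa using Finset.le_sup (f := κ') hj) (hκ' j), huW j⟩, rfl⟩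
    rw [h, Submodule.mem_bot, Submodule.mkQ_apply, Submodule.Quotient.mk_eq_zero] at h1
    exact hcon j h1
  have hsum : ∀ k, ∑ j ∈ Finset.range r, Module.finrank F (N j k) ≤ (c * (κ + k + 1)) ^ n :=
    fun k => (Nat.le_of_add_right_le (sum_finrank_map_mkQ_le hW (Γ (κ + k)) r)).trans (hc _)
  -- Since `κ + 1 = m`, this bounds the dimension of `Γ (κ + k)` for every `k ≤ 4nm`.
  set B := (c * ((4 * n + 1) * m)) ^ n with hB
  have hle : ∀ k, k ≤ 4 * n * m → (c * (κ + k + 1)) ^ n ≤ B := fun k hk => by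
    refine Nat.pow_le_pow_left (Nat.mul_le_mul_left c ?_) n
    rw [add_mul]
    omega
  have hterm : ∀ j ∈ Finset.range r, m ^ (2 * n) ≤ Module.finrank F (N j (2 * n * m)) * B := by
    intro j hj
    refine ((hNc j).pow_le_finrank_mul_finrank (hN0 j hj) m).trans (Nat.mul_le_mul_left _ ?_)
    exact (Finset.single_le_sum (f := fun j => Module.finrank F (N j (4 * n * m)))
      (fun _ _ => Nat.zero_le _) hj).trans ((hsum _).trans (hle _ le_rfl))
  have h1 := Finset.sum_le_sum hterm
  rw [← Finset.sum_mul, Finset.sum_const, Finset.card_range, smul_eq_mul] at h1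
  -- In each product one factor was bounded by `B` separately; the other factors are now summed over
  -- `j`, and their total is again at most `B`.
  have h2 : r * m ^ (2 * n) ≤ B * B :=
    h1.trans (Nat.mul_le_mul_right B ((hsum _).trans (hle _ (by gcongr; omega))))
  have h3 : B * B = (c * (4 * n + 1)) ^ (2 * n) * m ^ (2 * n) := by
    rw [hB, ← pow_add, ← two_mul, ← mul_assoc, mul_pow]
  rw [h3, hr] at h2
  have := Nat.le_of_mul_le_mul_right h2 (pow_pos (Nat.succ_pos κ) _)
  omega

end Counting

/-! ### Passage to the field of fractions. -/

section Localization

open TensorProduct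

variable {R M : Type*} [CommRing R] [AddCommGroup M] [Module R M] {n : ℕ}
  {T : WeylOps R M n}

/-- Base change of the operators. -/
def baseChange (T : WeylOps R M n) (F : Type*) [CommRing F] [Algebra R F] :
    WeylOps F (F ⊗[R] M) n where
  X i := Module.End.baseChangeHom R F M (T.X i)
  D i := Module.End.baseChangeHom R F M (T.D i)
  X_comm i j := by rw [← map_mul, T.X_comm, map_mul]
  D_comm i j := by rw [← map_mul, T.D_comm, map_mul]
  D_X i j := by
    rw [← map_mul, T.D_X, map_add, map_mul]
    split_ifs <;> simp

/-- The subspace of `F ⊗ M` spanned by a submodule of `M`. -/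
abbrev spanBaseChange (F : Type*) [CommRing F] [Algebra R F] (W : Submodule R M) :
    Submodule F (F ⊗[R] M) :=
  Submodule.span F (TensorProduct.mk R F M 1 '' W)

theorem spanBaseChange_le_comap (F : Type*) [CommRing F] [Algebra R F] {W W' : Submodule R M}
    {A : Module.End R M} (h : W ≤ W'.comap A) :
    spanBaseChange F W ≤ (spanBaseChange F W').comap (Module.End.baseChangeHom R F M A) := by
  rw [Submodule.span_le]
  rintro _ ⟨v, hv, rfl⟩
  exact Submodule.subset_span ⟨A v, h hv, rfl⟩

/-- The chain is extended to the fraction field, where dimension counting applies; the resulting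
membership becomes one over `R` after clearing denominators. -/
theorem Compatible.exists_smul_mem_succ [IsDomain R] [CharZero R] {Γ : ℕ → Submodule R M}
    (hΓ : T.Compatible Γ) (c : ℕ)
    (hc : ∀ k, ∃ s : Finset M, s.card ≤ (c * (k + 1)) ^ n ∧ Submodule.span R s = Γ k)
    {W : ℕ → Submodule R M} (hW : Antitone W) (hWs : ∀ j, T.Stable (W j)) {u : ℕ → M}
    (huW : ∀ j, u j ∈ W j) (huΓ : ∀ j, ∃ k, u j ∈ Γ k) :
    ∃ j, ∃ b : R, b ≠ 0 ∧ b • u j ∈ W (j + 1) := by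
  classical
  let F := FractionRing R
  have hmono : ∀ {W W' : Submodule R M}, W ≤ W' → spanBaseChange F W ≤ spanBaseChange F W' :=
    fun h => Submodule.span_mono (Set.image_mono h)
  have hfin : ∀ k, ∃ s : Finset (F ⊗[R] M), s.card ≤ (c * (k + 1)) ^ n ∧
      Submodule.span F s = spanBaseChange F (Γ k) := by
    intro k
    obtain ⟨s, hs, hs'⟩ := hc k
    refine ⟨s.image (TensorProduct.mk R F M 1), Finset.card_image_le.trans hs, ?_⟩
    rw [spanBaseChange, ← hs', ← Submodule.map_coe, Submodule.map_span, Submodule.span_span_of_tower,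
      Finset.coe_image]
  have hfd : ∀ k, FiniteDimensional F (spanBaseChange F (Γ k)) := by
    intro k
    obtain ⟨s, -, hs⟩ := hfin k
    rw [← hs]
    exact FiniteDimensional.span_finset F s
  have hcomp : (T.baseChange F).Compatible fun k => spanBaseChange F (Γ k) :=
    ⟨fun _ _ h => hmono (hΓ.1 h), fun i k => ⟨spanBaseChange_le_comap F (hΓ.2 i k).1,
      spanBaseChange_le_comap F (hΓ.2 i k).2⟩⟩
  obtain ⟨j, hj⟩ := hcomp.exists_mem_succ c
    (fun k => by
      obtain ⟨s, hs, hs'⟩ := hfin k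
      rw [← hs']
      exact (finrank_span_finset_le_card s).trans hs)
    (W := fun j => spanBaseChange F (W j)) (fun _ _ h => hmono (hW h))
    (fun j i => ⟨spanBaseChange_le_comap F (hWs j i).1, spanBaseChange_le_comap F (hWs j i).2⟩)
    (u := fun j => TensorProduct.mk R F M 1 (u j))
    (fun j => Submodule.subset_span ⟨_, huW j, rfl⟩)
    (fun j => (huΓ j).imp fun k hk => Submodule.subset_span ⟨_, hk, rfl⟩)
  rw [spanBaseChange, ← Submodule.localized'_eq_span F (nonZeroDivisors R)
    (TensorProduct.mk R F M 1), Submodule.mem_localized'] at hj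
  obtain ⟨w, hw, s, hs⟩ := hj
  -- Here `s` is the denominator; the second factor `t` is needed because `M` may have torsion, so
  -- that an equality in `F ⊗ M` holds in `M` only up to a nonzero multiple.
  rw [IsLocalizedModule.mk'_eq_iff, Submonoid.smul_def, ← map_smul,
    IsLocalizedModule.eq_iff_exists (nonZeroDivisors R)] at hs
  obtain ⟨t, ht⟩ := hs
  refine ⟨j, t * s, mul_ne_zero (nonZeroDivisors.ne_zero t.2) (nonZeroDivisors.ne_zero s.2), ?_⟩
  rw [mul_smul]
  rw [Submonoid.smul_def, Submonoid.smul_def] at ht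
  rw [← ht]
  exact (W (j + 1)).smul_mem _ hw

end Localization

end WeylOps

section

variable {K : Type*} [Field K] {n : ℕ} (f : MvPolynomial (Fin n) K)

/-! ### `M` as a module over `K[s]` with Weyl operators -/

theorem WeylS.commute_ofKs (b : K[X]) (P : WeylS K n) : Commute (WeylS.ofKs K b : WeylS K n) P := by
  induction b using Polynomial.induction_on' with
  | add p q hp hq =>
    rw [map_add]
    exact hp.add_left hq
  | monomial m a =>
    rw [← Polynomial.C_mul_X_pow_eq_monomial, map_mul, map_pow]
    simp only [WeylS.ofKs, Polynomial.coe_mapRingHom, Polynomial.map_C, Polynomial.map_X]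
    exact (show Commute _ P from Algebra.commutes (A := WeylS K n) a P).mul_left
      ((Polynomial.commute_X P).pow_left m)

theorem action_ofKs (b : K[X]) (g : Rfs f) :
    action f (WeylS.ofKs K b) g = b.map (algebraMap K (Localization.Away f)) * g := by
  have h : (action f).comp (WeylS.ofKs K (n := n)) =
      (Algebra.lmul K (Rfs f)).toRingHom.comp
        (Polynomial.mapRingHom (algebraMap K (Localization.Away f))) := by
    refine Polynomial.ringHom_ext (fun a => ?_) ?_
    · refine LinearMap.ext fun g => ?_
      simp [action, WeylS.ofKs, eval₂RingHom', Algebra.smul_def]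
    · refine LinearMap.ext fun g => ?_
      simp [action, WeylS.ofKs, eval₂RingHom', opS_apply]
  exact congrArg (fun φ => φ b g) h

theorem action_C (P : Weyl K n) : action f (C P) = weylAction f P := by
  simp [action, eval₂RingHom']

theorem action_X : action f X = opS f := by
  simp [action, eval₂RingHom']

theorem action_ofPoly (p : MvPolynomial (Fin n) K) (g : Rfs f) :
    action f (WeylS.ofPoly K p) g = C (algebraMap _ (Localization.Away f) p) * g := by
  have h : (weylAction f).comp (Weyl.ofPoly K (n := n)) =
      (Algebra.lmul K (Rfs f)).comp ((IsScalarTower.toAlgHom K (Localization.Away f) (Rfs f)).comp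
        (IsScalarTower.toAlgHom K (MvPolynomial (Fin n) K) (Localization.Away f))) := by
    refine MvPolynomial.algHom_ext fun i => ?_
    rw [AlgHom.comp_apply, Weyl.ofPoly_X, weylAction_x]
    rfl
  have h1 := congrArg (fun φ => φ p g) h
  rw [WeylS.ofPoly, RingHom.comp_apply, action_C]
  exact h1

/-- The `K[s]`-module structure on `M`. -/
instance : Module K[X] (FsModule f) := Module.compHom (FsModule f) (WeylS.ofKs K (n := n))

theorem ofKs_smul (b : K[X]) (m : FsModule f) : (WeylS.ofKs K b : WeylS K n) • m = b • m := rfl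

/-- The element `g · f^s` of `M`. -/
def mkFs (g : Rfs f) : FsModule f := g

theorem smul_mkFs (P : WeylS K n) (g : Rfs f) : P • mkFs f g = mkFs f (action f P g) := rfl

theorem Ks_smul_mkFs (b : K[X]) (g : Rfs f) :
    b • mkFs f g = mkFs f (b.map (algebraMap K (Localization.Away f)) * g) := by
  rw [← ofKs_smul, smul_mkFs, action_ofKs]

theorem mkFs_add (g h : Rfs f) : mkFs f (g + h) = mkFs f g + mkFs f h := rfl

/-- An element of the Weyl algebra acts `K[s]`-linearly on `M`. -/
def weylEnd : Weyl K n →+* Module.End K[X] (FsModule f) where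
  toFun P :=
    { toFun := fun m => (C P : WeylS K n) • m
      map_add' := smul_add _
      map_smul' := fun b m => by
        rw [RingHom.id_apply, ← ofKs_smul, ← ofKs_smul, smul_smul, smul_smul,
          (WeylS.commute_ofKs b _).eq] }
  map_one' := LinearMap.ext fun m => by
    change (C (1 : Weyl K n)) • m = m
    rw [C_1, one_smul]
  map_mul' P Q := LinearMap.ext fun m => by
    change (C (P * Q)) • m = C P • C Q • m
    rw [C_mul, mul_smul]
  map_zero' := LinearMap.ext fun m => by
    change (C (0 : Weyl K n)) • m = 0
    rw [C_0, zero_smul]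
  map_add' P Q := LinearMap.ext fun m => by
    change (C (P + Q)) • m = C P • m + C Q • m
    rw [C_add, add_smul]

/-- The Weyl operators on `M`. -/
def fsOps : WeylOps K[X] (FsModule f) n where
  X i := weylEnd f (Weyl.x K i)
  D i := weylEnd f (Weyl.d K i)
  X_comm i j := by rw [← map_mul, Weyl.x_mul_x, map_mul]
  D_comm i j := by rw [← map_mul, Weyl.d_mul_d, map_mul]
  D_X i j := by
    rw [← map_mul, Weyl.d_mul_x, map_add, map_mul]
    split_ifs <;> simp

theorem fsOps_X_mkFs (i : Fin n) (g : Rfs f) : (fsOps f).X i (mkFs f g) = mkFs f (opX f i g) := by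
  change (C (Weyl.x K i)) • mkFs f g = _
  rw [smul_mkFs, action_C, weylAction_x]

theorem fsOps_D_mkFs (i : Fin n) (g : Rfs f) : (fsOps f).D i (mkFs f g) = mkFs f (opD f i g) := by
  change (C (Weyl.d K i)) • mkFs f g = _
  rw [smul_mkFs, action_C, weylAction_d]

/-- The cyclic `D_n[s]`-submodule of `M` generated by `u`, as a `K[s]`-submodule. -/
def cyclic (u : FsModule f) : Submodule K[X] (FsModule f) where
  carrier := Set.range fun P : WeylS K n => P • u
  add_mem' := by
    rintro _ _ ⟨P, rfl⟩ ⟨Q, rfl⟩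
    exact ⟨P + Q, add_smul _ _ _⟩
  zero_mem' := ⟨0, zero_smul _ _⟩
  smul_mem' := by
    rintro b _ ⟨P, rfl⟩
    exact ⟨WeylS.ofKs K b * P, mul_smul _ _ _⟩

theorem stable_cyclic (u : FsModule f) : (fsOps f).Stable (cyclic f u) := by
  refine fun i => ⟨?_, ?_⟩ <;> rintro _ ⟨P, rfl⟩ <;> exact ⟨C _ * P, mul_smul _ _ _⟩

/-! ### The filtration of `M` by pole order and degree -/

section Away

variable {R : Type*} [CommRing R] [Algebra K R] (E : Derivation K R R) (a : R)

theorem extendAway_invSelf_pow (k : ℕ) :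
    extendAway E a (IsLocalization.Away.invSelf a ^ k) =
      -(k : Localization.Away a) * algebraMap R _ (E a) *
        IsLocalization.Away.invSelf a ^ (k + 1) := by
  have hf := IsLocalization.Away.mul_invSelf (S := Localization.Away a) a
  have key : extendAway E a (IsLocalization.Away.invSelf a) =
      - (algebraMap R _ (E a)) * IsLocalization.Away.invSelf a ^ 2 := by
    have h1 := congrArg (extendAway E a) hf
    simp only [Derivation.leibniz, smul_eq_mul, extendAway_algebraMap,
      Derivation.map_one_eq_zero] at h1
    linear_combination IsLocalization.Away.invSelf a * h1 -
      extendAway E a (IsLocalization.Away.invSelf a) * hf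
  induction k with
  | zero => simp
  | succ k ih =>
    rw [pow_succ, Derivation.leibniz, ih, key]
    simp only [smul_eq_mul]
    push_cast
    ring

end Away

/-- The element `g / f^k` of `R_n[1/f]`. -/
def quotPow (k : ℕ) (g : MvPolynomial (Fin n) K) : Localization.Away f :=
  algebraMap _ (Localization.Away f) g * IsLocalization.Away.invSelf f ^ k

theorem quotPow_succ (k : ℕ) (g : MvPolynomial (Fin n) K) :
    quotPow f (k + 1) (g * f) = quotPow f k g := by
  have hf := IsLocalization.Away.mul_invSelf (S := Localization.Away f) f
  rw [quotPow, quotPow, map_mul, pow_succ]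
  linear_combination (algebraMap _ (Localization.Away f) g *
    IsLocalization.Away.invSelf f ^ k) * hf

theorem quotPow_pow_mul (k : ℕ) (g : MvPolynomial (Fin n) K) :
    quotPow f k (g * f ^ k) = quotPow f 0 g := by
  induction k with
  | zero => simp
  | succ k ih => rw [pow_succ, ← mul_assoc, quotPow_succ, ih]

/-- The quotient rule, with the `s`-part kept apart: both terms have pole order `k + 1` and
numerators of controlled degree. -/
theorem opD_quotPow (i : Fin n) (k : ℕ) (g : MvPolynomial (Fin n) K) :
    mkFs f (opD f i (C (quotPow f k g))) =
      mkFs f (C (quotPow f (k + 1) (pd i g * f - (k : MvPolynomial (Fin n) K) * g * pd i f))) +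
        (X : K[X]) • mkFs f (C (quotPow f (k + 1) (g * pd i f))) := by
  rw [Ks_smul_mkFs, ← mkFs_add, opD_apply, Polynomial.map_X]
  congr 1
  have h1 : coeffwise (extendAway (pd i) f) (C (quotPow f k g)) =
      C (extendAway (pd i) f (quotPow f k g)) := by
    ext l
    rw [coeff_coeffwise, coeff_C, coeff_C]
    split_ifs <;> simp
  rw [h1, ← C_mul (a := logDer (pd i) f)]
  congr 1
  · congr 1
    have hf := IsLocalization.Away.mul_invSelf (S := Localization.Away f) f
    simp only [quotPow, Derivation.leibniz, smul_eq_mul, extendAway_algebraMap,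
      extendAway_invSelf_pow, map_sub, map_mul, map_natCast]
    linear_combination (-algebraMap _ (Localization.Away f) (pd i g) *
      IsLocalization.Away.invSelf f ^ k) * hf
  · refine congrArg (fun y : Localization.Away f => X * C y) ?_
    rw [logDer, quotPow, quotPow, map_mul]
    ring

/-- The `K[s]`-span of the elements `(g / f^k) · f^s` with `deg g ≤ (deg f + 1) k`. -/
def poleFiltration (k : ℕ) : Submodule K[X] (FsModule f) :=
  Submodule.span K[X] ((fun g => mkFs f (C (quotPow f k g))) ''
    {g | g.totalDegree ≤ (f.totalDegree + 1) * k})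

variable {f} in
theorem mem_poleFiltration {k : ℕ} {g : MvPolynomial (Fin n) K}
    (hg : g.totalDegree ≤ (f.totalDegree + 1) * k) :
    mkFs f (C (quotPow f k g)) ∈ poleFiltration f k :=
  Submodule.subset_span ⟨g, hg, rfl⟩

theorem poleFiltration_le_succ (k : ℕ) : poleFiltration f k ≤ poleFiltration f (k + 1) := by
  rw [poleFiltration, Submodule.span_le]
  rintro _ ⟨g, hg, rfl⟩
  change mkFs f (C (quotPow f k g)) ∈ _
  rw [← quotPow_succ]
  refine mem_poleFiltration ((MvPolynomial.totalDegree_mul _ _).trans ?_)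
  rw [Set.mem_ofPred_eq] at hg
  rw [mul_add]
  omega

/-- The allowed numerator degree grows by `deg f + 1` per step. This is what `x_i` needs, since `x_i
g / f^k = x_i g f / f^(k+1)`; derivatives need less. -/
theorem compatible_poleFiltration : (fsOps f).Compatible (poleFiltration f) := by
  refine ⟨monotone_nat_of_le_succ (poleFiltration_le_succ f), fun i k => ⟨?_, ?_⟩⟩
  · rw [poleFiltration, Submodule.span_le]
    rintro _ ⟨g, hg, rfl⟩
    change (fsOps f).X i (mkFs f (C (quotPow f k g))) ∈ poleFiltration f (k + 1)
    have : opX f i (C (quotPow f k g)) = C (quotPow f (k + 1) (MvPolynomial.X i * g * f)) := by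
      rw [quotPow_succ, opX_apply, ← C_mul]
      refine congrArg C ?_
      rw [quotPow, quotPow, map_mul, mul_assoc]
    rw [fsOps_X_mkFs, this]
    refine mem_poleFiltration ((MvPolynomial.totalDegree_mul _ _).trans ?_)
    have h1 := MvPolynomial.totalDegree_mul (MvPolynomial.X i) g
    rw [MvPolynomial.totalDegree_X] at h1
    rw [Set.mem_ofPred_eq] at hg
    rw [mul_add]
    omega
  · rw [poleFiltration, Submodule.span_le]
    rintro _ ⟨g, hg, rfl⟩
    change (fsOps f).D i (mkFs f (C (quotPow f k g))) ∈ poleFiltration f (k + 1)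
    rw [fsOps_D_mkFs, opD_quotPow]
    rw [Set.mem_ofPred_eq] at hg
    have hg' : (pd i g).totalDegree ≤ _ := WeylOps.totalDegree_pderiv_le i g
    have hf' : (pd i f).totalDegree ≤ _ := WeylOps.totalDegree_pderiv_le i f
    have h1 := MvPolynomial.totalDegree_mul (pd i g) f
    have h2 := MvPolynomial.totalDegree_mul g (pd i f)
    have h3 := MvPolynomial.totalDegree_smul_le (k : K) (g * pd i f)
    have h4 : (k : MvPolynomial (Fin n) K) * g * pd i f = (k : K) • (g * pd i f) := by
      rw [MvPolynomial.smul_eq_C_mul, map_natCast, mul_assoc]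
    have h5 := MvPolynomial.totalDegree_sub (pd i g * f) ((k : K) • (g * pd i f))
    rw [h4]
    refine add_mem (mem_poleFiltration ?_) (Submodule.smul_mem _ _ (mem_poleFiltration ?_)) <;>
    · rw [mul_add]
      omega

/-- Monomial numerators suffice, and those of degree at most `d = (deg f + 1) k` have each of their
`n` exponents below `d + 1`, which is at most `(deg f + 1) (k + 1)`. -/
theorem exists_finset_span_eq_poleFiltration (k : ℕ) :
    ∃ s : Finset (FsModule f), s.card ≤ ((f.totalDegree + 1) * (k + 1)) ^ n ∧
      Submodule.span K[X] s = poleFiltration f k := by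
  classical
  set d := (f.totalDegree + 1) * k with hd
  let mon : (Fin n → Fin (d + 1)) → (Fin n →₀ ℕ) := fun a =>
    Finsupp.equivFunOnFinite.symm fun i => (a i : ℕ)
  let gen : (Fin n →₀ ℕ) → FsModule f := fun m =>
    mkFs f (C (quotPow f k (MvPolynomial.monomial m 1)))
  refine ⟨((Finset.univ.filter fun a => (mon a).degree ≤ d).image fun a => gen (mon a)), ?_, ?_⟩
  · refine Finset.card_image_le.trans ((Finset.card_filter_le _ _).trans ?_)
    rw [Finset.card_univ, Fintype.card_fun, Fintype.card_fin, Fintype.card_fin]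
    refine Nat.pow_le_pow_left ?_ n
    rw [mul_add]
    omega
  · refine le_antisymm (Submodule.span_le.mpr ?_) (Submodule.span_le.mpr ?_)
    · intro m hm
      rw [Finset.mem_coe, Finset.mem_image] at hm
      obtain ⟨a, ha, rfl⟩ := hm
      exact mem_poleFiltration ((MvPolynomial.totalDegree_monomial_le _ _).trans
        (Finset.mem_filter.mp ha).2)
    · rintro _ ⟨g, hg, rfl⟩
      rw [Set.mem_ofPred_eq] at hg
      have hsum : mkFs f (C (quotPow f k g)) =
          ∑ m ∈ g.support, (C (g.coeff m) : K[X]) • gen m := by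
        have hL : ∀ m, (C (g.coeff m) : K[X]) • gen m =
            mkFs f (C (quotPow f k (MvPolynomial.monomial m (g.coeff m)))) := by
          intro m
          rw [Ks_smul_mkFs, Polynomial.map_C, ← C_mul, quotPow, quotPow, ← mul_assoc,
            IsScalarTower.algebraMap_apply K (MvPolynomial (Fin n) K) (Localization.Away f),
            ← map_mul, MvPolynomial.algebraMap_eq, MvPolynomial.C_mul_monomial, mul_one]
        rw [Finset.sum_congr rfl fun m _ => hL m]
        conv_lhs => rw [← MvPolynomial.support_sum_monomial_coeff g]
        rw [quotPow, map_sum, Finset.sum_mul, map_sum]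
        rfl
      change mkFs f (C (quotPow f k g)) ∈ _
      rw [hsum]
      refine Submodule.sum_mem _ fun m hm => Submodule.smul_mem _ _ (Submodule.subset_span ?_)
      have hdeg : m.degree ≤ d := (MvPolynomial.le_totalDegree hm).trans hg
      have hlt : ∀ i, m i < d + 1 := fun i =>
        Nat.lt_succ_of_le ((Finsupp.le_degree i m).trans hdeg)
      rw [Finset.mem_coe, Finset.mem_image]
      have hmon : mon (fun i => ⟨m i, hlt i⟩) = m := Finsupp.ext fun i => rfl
      exact ⟨fun i => ⟨m i, hlt i⟩, by simp [hmon, hdeg], by rw [hmon]⟩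

/-- A functional equation for some power of `f`. -/
theorem exists_functionalEquation_pow [CharZero K] :
    ∃ (j : ℕ) (b : K[X]) (P : WeylS K n), b ≠ 0 ∧
      action f P (C (algebraMap _ (Localization.Away f) (f ^ (j + 1)))) =
        b.map (algebraMap K (Localization.Away f)) *
          C (algebraMap _ (Localization.Away f) (f ^ j)) := by
  have : CharZero K[X] := inferInstance
  let u : ℕ → FsModule f := fun j => mkFs f (C (algebraMap _ (Localization.Away f) (f ^ j)))
  have hu : ∀ j, (WeylS.ofPoly K f : WeylS K n) • u j = u (j + 1) := by
    intro j
    rw [smul_mkFs, action_ofPoly, ← C_mul, ← map_mul, ← pow_succ']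
  obtain ⟨j, b, hb, P, hP⟩ := (compatible_poleFiltration f).exists_smul_mem_succ
    (f.totalDegree + 1) (exists_finset_span_eq_poleFiltration f) (W := fun j => cyclic f (u j))
    (antitone_nat_of_succ_le fun j => by
      rintro _ ⟨P, rfl⟩
      exact ⟨P * WeylS.ofPoly K f, by simp only [mul_smul, hu]⟩)
    (fun j => stable_cyclic f _) (u := u) (fun j => ⟨1, one_smul _ _⟩)
    -- With `l = deg f * j`, the numerator in `f^j = f^(j+l) / f^l` has degree at most `deg f * (j +
    -- l) = (deg f + 1) * l`, exactly the allowed bound.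
    (fun j => ⟨f.totalDegree * j, by
      have h1 : u j = mkFs f (C (quotPow f (f.totalDegree * j)
          (f ^ j * f ^ (f.totalDegree * j)))) := by
        rw [quotPow_pow_mul, quotPow, pow_zero, mul_one]
      rw [h1]
      refine mem_poleFiltration ?_
      rw [← pow_add]
      refine (MvPolynomial.totalDegree_pow _ _).trans (le_of_eq ?_)
      ring⟩)
  exact ⟨j, b, P, hb, (hP.trans (Ks_smul_mkFs f b _) :)⟩

end

section

variable {K : Type*} [Field K] {n : ℕ} (f : MvPolynomial (Fin n) K)

/-! ### The shift `s ↦ s - 1` -/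

/-- The shift `g(s) · f^s ↦ g(s - 1) · f^(s - 1)` on coefficients of `f^s`. -/
def shift (g : Rfs f) : Rfs f :=
  C (IsLocalization.Away.invSelf f) * g.comp (X - 1)

theorem shift_add (g h : Rfs f) : shift f (g + h) = shift f g + shift f h := by
  rw [shift, shift, shift, add_comp, mul_add]

theorem shift_map_mul (b : K[X]) (g : Rfs f) :
    shift f (b.map (algebraMap K (Localization.Away f)) * g) =
      (b.comp (X - 1)).map (algebraMap K (Localization.Away f)) * shift f g := by
  rw [shift, shift, mul_comp, Polynomial.map_comp, Polynomial.map_sub, Polynomial.map_X,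
    Polynomial.map_one]
  ring

theorem shift_pow_succ (j : ℕ) :
    shift f (C (algebraMap _ (Localization.Away f) (f ^ (j + 1)))) =
      C (algebraMap _ (Localization.Away f) (f ^ j)) := by
  have hf := IsLocalization.Away.mul_invSelf (S := Localization.Away f) f
  rw [shift, C_comp, ← C_mul]
  congr 1
  rw [pow_succ, map_mul]
  linear_combination (algebraMap _ (Localization.Away f) (f ^ j)) * hf

theorem coeffwise_comp {A : Type*} [CommRing A] [Algebra K A] (E : Derivation K A A) (g : A[X]) :
    coeffwise E (g.comp (X - 1)) = (coeffwise E g).comp (X - 1) := by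
  have hmul : ∀ q : A[X], coeffwise E ((X - 1) * q) = (X - 1) * coeffwise E q := by
    intro q
    rw [sub_mul, map_sub, coeffwise_X_mul, one_mul, sub_mul, one_mul]
  induction g using Polynomial.induction_on' with
  | add p q hp hq => rw [add_comp, map_add, hp, hq, map_add, add_comp]
  | monomial m a =>
    induction m with
    | zero =>
      have h : ∀ a : A, coeffwise E (C a) = C (E a) := by
        intro a
        ext l
        rw [coeff_coeffwise, coeff_C, coeff_C]
        split_ifs <;> simp
      rw [monomial_zero_left, C_comp, h, C_comp]
    | succ m ih =>
      rw [← X_mul_monomial, mul_comp, X_comp, hmul, ih, coeffwise_X_mul, mul_comp, X_comp]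

/-- Differentiating the factor `1/f` contributes `-(∂f/∂x_i)/f`, which turns the coefficient `s` of
the logarithmic derivative into `s - 1`. -/
theorem opD_shift (i : Fin n) (g : Rfs f) : opD f i (shift f g) = shift f (opD f i g) := by
  have hE := extendAway_invSelf_pow (pd i) f 1
  rw [pow_one, Nat.cast_one] at hE
  rw [opD_apply, opD_apply, shift, shift, coeffwise_C_mul, coeffwise_comp, hE, add_comp, mul_comp,
    mul_comp, X_comp, C_comp, logDer]
  simp only [map_mul, map_neg, map_one, map_pow]
  ring

theorem opX_shift (i : Fin n) (g : Rfs f) : opX f i (shift f g) = shift f (opX f i g) := by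
  rw [opX_apply, opX_apply, shift, shift, mul_comp, C_comp]
  ring

theorem weylAction_shift (P : Weyl K n) (g : Rfs f) :
    weylAction f P (shift f g) = shift f (weylAction f P g) := by
  obtain ⟨a, rfl⟩ := Weyl.mk_surjective K P
  induction a using FreeAlgebra.induction generalizing g with
  | grade0 r =>
    rw [AlgHom.commutes, AlgHom.commutes, Module.algebraMap_end_apply, Module.algebraMap_end_apply,
      shift, shift, smul_comp, mul_smul_comm]
  | grade1 x =>
    cases x with
    | x i => exact (weylAction_x f i).symm ▸ opX_shift f i g
    | d i => exact (weylAction_d f i).symm ▸ opD_shift f i g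
  | mul a b ha hb => rw [map_mul, map_mul, Module.End.mul_apply, hb, ha, Module.End.mul_apply]
  | add a b ha hb =>
    rw [map_add, map_add, LinearMap.add_apply, ha, hb, LinearMap.add_apply, shift_add]

/-- The shift commutes with `D_n` and turns `s` into `s - 1`, so `Q(s) = P(s - 1)` works. -/
theorem exists_shift_action (P : WeylS K n) :
    ∃ Q : WeylS K n, ∀ g, shift f (action f P g) = action f Q (shift f g) := by
  induction P using Polynomial.induction_on' with
  | add p q hp hq =>
    obtain ⟨p', hp⟩ := hp
    obtain ⟨q', hq⟩ := hq
    exact ⟨p' + q', fun g => by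
      rw [map_add, map_add, LinearMap.add_apply, LinearMap.add_apply, shift_add, hp, hq]⟩
  | monomial m a =>
    induction m with
    | zero =>
      refine ⟨C a, fun g => ?_⟩
      rw [monomial_zero_left, action_C, weylAction_shift]
    | succ m ih =>
      obtain ⟨Q, hQ⟩ := ih
      refine ⟨(X - 1) * Q, fun g => ?_⟩
      rw [← X_mul_monomial, map_mul, map_mul, Module.End.mul_apply, Module.End.mul_apply, ← hQ,
        map_sub, map_one, action_X, LinearMap.sub_apply, opS_apply, opS_apply, Module.End.one_apply,
        shift, mul_comp, X_comp, shift]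
      ring

/-- Each shift lowers the exponents `j + 1` and `j` by one and replaces `b(s)` by `b(s - 1)`, which
is still nonzero. -/
theorem exists_satisfiesFunctionalEquation_of_pow (j : ℕ) : ∀ (b : K[X]) (P : WeylS K n), b ≠ 0 →
    action f P (C (algebraMap _ (Localization.Away f) (f ^ (j + 1)))) =
      b.map (algebraMap K (Localization.Away f)) *
        C (algebraMap _ (Localization.Away f) (f ^ j)) →
    ∃ b : K[X], b ≠ 0 ∧ SatisfiesFunctionalEquation f b := by
  induction j with
  | zero =>
    intro b P hb h
    refine ⟨b, hb, P, ?_⟩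
    rw [smul_fs, smul_fs, map_mul, Module.End.mul_apply, action_ofPoly, action_ofKs, mul_one,
      mul_one]
    rw [zero_add, pow_one, pow_zero, map_one, C_1, mul_one] at h
    exact h
  | succ j ih =>
    intro b P hb h
    obtain ⟨Q, hQ⟩ := exists_shift_action f P
    refine ih (b.comp (X - 1)) Q (fun h0 => hb ?_) ?_
    · rw [← map_one C] at h0
      have h1 := congrArg (fun p => p.comp (X + C 1)) h0
      simpa [comp_assoc] using h1
    · have h1 := congrArg (shift f) h
      rwa [hQ, shift_map_mul, shift_pow_succ, shift_pow_succ] at h1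

/-! ### The Bernstein-Sato polynomial -/

/-- **Bernstein's theorem**: the Bernstein-Sato polynomial exists. -/
theorem exists_isBernsteinSato [CharZero K] : ∃ b, IsBernsteinSato f b := by
  classical
  obtain ⟨j, b₀, P, hb₀, hP⟩ := exists_functionalEquation_pow f
  obtain ⟨b, hb, hfe⟩ := exists_satisfiesFunctionalEquation_of_pow f j b₀ P hb₀ hP
  have h0 : SatisfiesFunctionalEquation f (0 : K[X]) := ⟨0, by rw [zero_mul, map_zero]⟩
  have hmon : ∃ d, ∃ c : K[X], c.Monic ∧ SatisfiesFunctionalEquation f c ∧ c.natDegree = d := by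
    refine ⟨_, C b.leadingCoeff⁻¹ * b, ?_, ?_, rfl⟩
    · rw [mul_comm]
      exact monic_mul_leadingCoeff_inv hb
    · simpa using hfe.C_mul_sub h0 b.leadingCoeff⁻¹
  obtain ⟨c, hc1, hc2, hc3⟩ := Nat.find_spec hmon
  exact ⟨c, hc1, hc2, fun c' h1 h2 => hc3 ▸ Nat.find_min' hmon ⟨c', h1, h2, rfl⟩⟩

theorem isBernsteinSato_bernsteinSato [CharZero K] : IsBernsteinSato f (bernsteinSato f) := by
  have h := exists_isBernsteinSato f
  rw [bernsteinSato, dif_pos h]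
  exact h.choose_spec

/-- The functional equation says that `b(s) - P(s) f` annihilates `f^s`. -/
theorem satisfiesFunctionalEquation_iff (b : K[X]) : SatisfiesFunctionalEquation f b ↔
    (WeylS.ofKs K b : WeylS K n) ∈ annFs f ⊔ Ideal.span {WeylS.ofPoly K f} := by
  rw [Submodule.mem_sup]
  constructor
  · rintro ⟨P, hP⟩
    refine ⟨WeylS.ofKs K b - P * WeylS.ofPoly K f, ?_, P * WeylS.ofPoly K f,
      Ideal.mem_span_singleton'.mpr ⟨P, rfl⟩, sub_add_cancel _ _⟩
    rw [annFs, Ideal.mem_torsionOf_iff, sub_smul, hP, sub_self]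
  · rintro ⟨A, hA, B, hB, hAB⟩
    obtain ⟨P, rfl⟩ := Ideal.mem_span_singleton'.mp hB
    rw [annFs, Ideal.mem_torsionOf_iff] at hA
    exact ⟨P, by rw [← hAB, add_smul, hA, zero_add]⟩

/-- Modulo `s + a`, the polynomial `p` is the nonzero constant `p(-a)`. -/
theorem eq_top_of_ofKs_mem {I : Ideal (WeylS K n)} {a : K}
    (ha : WeylS.ofKs K (X + C a) ∈ I) {p : K[X]} (hp : WeylS.ofKs K p ∈ I)
    (h : p.eval (-a) ≠ 0) : I = ⊤ := by
  obtain ⟨q, hq⟩ := X_sub_C_dvd_sub_C_eval (a := -a) (p := p)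
  rw [map_neg, sub_neg_eq_add] at hq
  have h1 : C (p.eval (-a))⁻¹ * p + (-(C (p.eval (-a))⁻¹ * q)) * (X + C a) = 1 := by
    have h2 : C (p.eval (-a))⁻¹ * C (p.eval (-a)) = 1 := by
      rw [← C_mul, inv_mul_cancel₀ h, C_1]
    linear_combination C (p.eval (-a))⁻¹ * hq + h2
  rw [Ideal.eq_top_iff_one, ← map_one (WeylS.ofKs K (n := n)), ← h1, map_add, map_mul, map_mul]
  exact I.add_mem (I.mul_mem_left _ hp) (I.mul_mem_left _ ha)

/-- If the left ideal `J` and `s + a` together generate `D_n[s]`, then `J` contains `c(s)` as soon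
as it contains `(s + a) c(s)`. -/
theorem ofKs_mem_of_sup_eq_top {J : Ideal (WeylS K n)} {a : K}
    (h : J ⊔ Ideal.span {WeylS.ofKs K (X + C a)} = ⊤) {c : K[X]}
    (hc : WeylS.ofKs K ((X + C a) * c) ∈ J) : WeylS.ofKs K c ∈ J := by
  rw [Ideal.eq_top_iff_one, Submodule.mem_sup] at h
  obtain ⟨A, hA, B, hB, hAB⟩ := h
  obtain ⟨Q, rfl⟩ := Ideal.mem_span_singleton'.mp hB
  -- Multiply `1 = A + Q (s + a)` by `c(s)`; because `c(s)` is central, it can be moved to the right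
  -- of `Q (s + a)` in the second term.
  have h1 : (WeylS.ofKs K c : WeylS K n) =
      WeylS.ofKs K c * A + Q * WeylS.ofKs K ((X + C a) * c) := by
    rw [map_mul, ← mul_assoc, ← (WeylS.commute_ofKs c (Q * WeylS.ofKs K (X + C a))).eq, ← mul_add, hAB,
      mul_one]
  rw [h1]
  exact J.add_mem (J.mul_mem_left _ hA) (J.mul_mem_left _ hc)

theorem isRoot_bernsteinSato_iff [CharZero K] (a : K) :
    ((bernsteinSato f).comp (-X)).IsRoot a ↔
      annFs f ⊔ Ideal.span {WeylS.ofPoly K f} ⊔ Ideal.span {WeylS.ofKs K (X + C a)} ≠ ⊤ := by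
  obtain ⟨hb, hfe, hmin⟩ := isBernsteinSato_bernsteinSato f
  have hroot : ((bernsteinSato f).comp (-X)).IsRoot a ↔ (bernsteinSato f).eval (-a) = 0 := by
    simp [IsRoot.def, eval_comp]
  rw [hroot]
  constructor
  · intro h0 htop
    have hdvd : X + C a ∣ bernsteinSato f := by
      rw [← sub_neg_eq_add, ← map_neg]
      exact dvd_iff_isRoot.mpr h0
    obtain ⟨c, hc⟩ := hdvd
    rw [satisfiesFunctionalEquation_iff, hc] at hfe
    have hcm : c.Monic := (monic_X_add_C a).of_mul_monic_left (hc ▸ hb)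
    have h1 := hmin c hcm ((satisfiesFunctionalEquation_iff f c).mpr
      (ofKs_mem_of_sup_eq_top htop hfe))
    rw [hc, (monic_X_add_C a).natDegree_mul hcm, natDegree_X_add_C] at h1
    omega
  · contrapose
    intro h0
    refine eq_top_of_ofKs_mem
      (Submodule.mem_sup_right (Ideal.subset_span rfl))
      (Submodule.mem_sup_left ((satisfiesFunctionalEquation_iff f _).mp hfe)) h0

/-! ### Specialization of `s` -/

/-- The specialization `P(s) ↦ P(a)`. -/
def specialize (a : K) : WeylS K n →+* Weyl K n :=
  eval₂RingHom' (RingHom.id _) (algebraMap K _ a) fun P => (Algebra.commutes a P).symm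

theorem specialize_apply (a : K) (P : WeylS K n) :
    specialize a P = P.eval (algebraMap K _ a) := rfl

theorem sub_C_eval_mem (a : K) (P : WeylS K n) :
    P - C (P.eval (algebraMap K (Weyl K n) a)) ∈
      (Ideal.span {X - C (algebraMap K (Weyl K n) a)} : Ideal (WeylS K n)) := by
  induction P using Polynomial.induction_on' with
  | add p q hp hq =>
    rw [eval_add, C_add, add_sub_add_comm]
    exact Ideal.add_mem _ hp hq
  | monomial m b =>
    rw [eval_monomial, C_mul, C_pow, ← C_mul_X_pow_eq_monomial, ← mul_sub,
      ← (commute_X (C (algebraMap K (Weyl K n) a))).geom_sum₂_mul]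
    exact Ideal.mul_mem_left _ _ (Ideal.mul_mem_left _ _ (Ideal.subset_span rfl))

/-- Evaluation at `a` kills the central element `s - a`, and conversely `P(s)` and `P(a)` differ by
a left multiple of `s - a`. So `1` can be carried between the two ideals along the inclusion `D_n →
D_n[s]` and the evaluation `D_n[s] → D_n`. -/
theorem span_specialize_eq_top_iff (a : K) (S : Set (WeylS K n)) :
    Ideal.span (specialize a '' S) = ⊤ ↔
      Ideal.span S ⊔ Ideal.span {WeylS.ofKs K (X - C a)} = ⊤ := by
  have hX : (WeylS.ofKs K (X - C a) : WeylS K n) = X - C (algebraMap K (Weyl K n) a) := by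
    simp [WeylS.ofKs]
  rw [hX, Ideal.eq_top_iff_one, Ideal.eq_top_iff_one]
  set I := Ideal.span S ⊔ Ideal.span {X - C (algebraMap K (Weyl K n) a)} with hI
  constructor
  · intro h
    have hle : Ideal.span (specialize a '' S) ≤ I.comap C := by
      rw [Ideal.span_le]
      rintro _ ⟨P, hP, rfl⟩
      have h1 := I.sub_mem (Submodule.mem_sup_left (Ideal.subset_span hP) : P ∈ I)
        (Submodule.mem_sup_right (sub_C_eval_mem a P) : _ ∈ I)
      rwa [sub_sub_cancel] at h1
    have h1 := hle h
    rwa [Ideal.mem_comap, C_1] at h1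
  · intro h
    have hle : I ≤ (Ideal.span (specialize a '' S)).comap (specialize a) := by
      rw [hI, sup_le_iff, Ideal.span_le, Ideal.span_le]
      refine ⟨fun P hP => Ideal.subset_span ⟨P, hP, rfl⟩, ?_⟩
      rintro _ rfl
      change specialize a _ ∈ Ideal.span (specialize a '' S)
      rw [specialize_apply, eval_sub, eval_X, eval_C, sub_self]
      exact Ideal.zero_mem _
    have h1 := hle h
    rwa [Ideal.mem_comap, map_one] at h1

end

end WeylBS

end

theorem corollary2p2 {K : Type*} [Field K] [CharZero K] {n : ℕ}
    (f : MvPolynomial (Fin n) K) (hf : f ≠ 0)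
    {k : ℕ} (P : Fin k → WeylBS.WeylS K n)
    (hP : Ideal.span (Set.range P) = WeylBS.annFs f)
    (α : ℚ) (hα : 0 < α) :
    List.TFAE
      [ ((WeylBS.bernsteinSato f).comp (-Polynomial.X)).IsRoot (α : K),
        Ideal.span (Set.range P ∪
            {WeylBS.WeylS.ofPoly K f, WeylBS.WeylS.ofKs K (Polynomial.X + Polynomial.C (α : K))})
          ≠ ⊤,
        Ideal.span (Set.range
              (fun i => (P i).eval (algebraMap K (WeylBS.Weyl K n) (-(α : K)))) ∪
            {WeylBS.Weyl.ofPoly K f})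
          ≠ ⊤ ] ∧
    (((WeylBS.bernsteinSato f).comp (-Polynomial.X)).IsRoot (α : K) →
      (Ideal.span (Set.range P ∪
          {WeylBS.WeylS.ofPoly K f, WeylBS.WeylS.ofKs K (Polynomial.X + Polynomial.C (α : K))})).comap
          (WeylBS.WeylS.ofKs K)
        = Ideal.span {Polynomial.X + Polynomial.C (α : K)}) := by
  have hspan : Ideal.span (Set.range P ∪
      {WeylBS.WeylS.ofPoly K f, WeylBS.WeylS.ofKs K (Polynomial.X + Polynomial.C (α : K))}) =
      WeylBS.annFs f ⊔ Ideal.span {WeylBS.WeylS.ofPoly K f} ⊔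
        Ideal.span {WeylBS.WeylS.ofKs K (Polynomial.X + Polynomial.C (α : K))} := by
    rw [Ideal.span_union, hP, Ideal.span_insert, sup_assoc]
  have h12 := WeylBS.isRoot_bernsteinSato_iff f (α : K)
  rw [← hspan] at h12
  have h23 := WeylBS.span_specialize_eq_top_iff (-(α : K))
    (Set.range P ∪ {WeylBS.WeylS.ofPoly K f})
  have himage : WeylBS.specialize (-(α : K)) '' (Set.range P ∪ {WeylBS.WeylS.ofPoly K f}) =
      Set.range (fun i => (P i).eval (algebraMap K (WeylBS.Weyl K n) (-(α : K)))) ∪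
        {WeylBS.Weyl.ofPoly K f} := by
    rw [Set.image_union, Set.image_singleton, ← Set.range_comp]
    congr 2
    exact Polynomial.eval_C
  rw [himage, Ideal.span_union _ {WeylBS.WeylS.ofPoly K f}, hP, map_neg Polynomial.C,
    sub_neg_eq_add, ← hspan] at h23
  refine ⟨?_, fun hroot => le_antisymm ?_ ?_⟩
  · tfae_have 1 ↔ 2 := h12
    tfae_have 2 ↔ 3 := not_congr h23.symm
    tfae_finish
  · intro p hp
    rw [Ideal.mem_span_singleton, ← sub_neg_eq_add, ← map_neg, Polynomial.dvd_iff_isRoot]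
    -- An element of the intersection not vanishing at `-α` would, together with `s + α`, generate
    -- the unit ideal, contradicting condition 2.
    by_contra h0
    exact h12.mp hroot (WeylBS.eq_top_of_ofKs_mem (Ideal.subset_span (by simp)) hp h0)
  · rw [Ideal.span_singleton_le_iff_mem, Ideal.mem_comap]
    exact Ideal.subset_span (by simp)
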